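/- Let $1\le k\le n$ be integers, $r>0$, and $D=\{(x,t)\in\mathbb{R}^n\times(-\infty,0]:|x|^2-r^2<t\}$. Write $Du$, $D^2u$ for the gradient and the matrix of second derivatives in $x$, $u_t$ for the derivative in $t$ (the left derivative at $t=0$), $\lambda(A)\in\mathbb{R}^n$ for the vector of eigenvalues of a symmetric matrix $A$, $\sigma_j(\lambda)=\sum_{i_1<\cdots<i_j}\lambda_{i_1}\cdots\lambda_{i_j}$, and $\Gamma_k=\{\lambda\in\mathbb{R}^n:\sigma_j(\lambda)>0,\ j=1,\dots,k\}$. The class $C^{2m,m}(D)$ consists of the functions whose derivatives $D_x^i\partial_t^j u$, $i+2j\le 2m$, exist and are continuous on $D$; $u\in C^{2m,m}(\overline D)$ means that in addition these derivatives extend continuously to $\overline D$. Let $\psi=\psi(x,t,z)\ge 0$ be bounded on $D\times\mathbb{R}$ and Lipschitz continuous with respect to $x$ and $z$, uniformly on $D\times\mathbb{R}$. Let $u\in C^{4,2}(D)\cap C^{2,1}(\overline D)$ be $k$-convex-monotone, that is, $\lambda(D^2u)\in\overline{\Gamma}_k$ on $D$ and $u$ is decreasing in $t$, and suppose that $$-u_t\,\sigma_k(\lambda(D^2u))=\psi(x,t,u)\quad\text{and}\quad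 -u_t\ge m_1>0\quad\text{in }D$$ for some constant $m_1$. Let $U,\Psi,L$ be numbers with $$\sup_D|u|\le U,\qquad \sup_{D\times\mathbb{R}}\psi\le\Psi,\qquad \sup_{D\times\mathbb{R}}(|\psi_x|+|\psi_z|)\le L,$$ for instance these suprema themselves; the last bound is understood as $|\psi(x,t,z)-\psi(y,t,w)|\le L\max(|x-y|,|z-w|)$ for $(x,t),(y,t)\in D$ and $z,w\in\mathbb{R}$. Then $$|Du(0,0)|\le C_1+C_2\,\frac{U}{r},$$ where $C_1>0$ is a constant depending only on $n,k,r,m_1,U,L$, and $C_2>0$ is a constant depending only on $n,k,m_1,\Psi$. If moreover $\psi$ is constant, then the estimate holds with $C_1$ replaced by $0$, that is, $|Du(0,0)|\le C_2\,U/r$ with the same $C_2$. -/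

import Mathlib

open Set

noncomputable section

namespace ParabolicHessian

/-- The `k`-th elementary symmetric function of `lam ∈ ℝⁿ`. -/
def sigma {n : ℕ} (k : ℕ) (lam : Fin n → ℝ) : ℝ :=
  ∑ s ∈ Finset.powersetCard k (Finset.univ : Finset (Fin n)), ∏ i ∈ s, lam i

/-- The open cone `Γ_k = {lam ∈ ℝⁿ : σ_j(lam) > 0 for j = 1, …, k}`. -/
def Gam (n k : ℕ) : Set (Fin n → ℝ) :=
  {lam | ∀ j : ℕ, 1 ≤ j → j ≤ k → 0 < sigma j lam}

/-- The vector of eigenvalues (with multiplicity) of a symmetric real matrix. The value on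
non-symmetric matrices is irrelevant: it is only applied to Hessians of `C²` functions. -/
def eigenvalueVector {n : ℕ} (A : Matrix (Fin n) (Fin n) ℝ) : Fin n → ℝ :=
  open Classical in if h : A.IsHermitian then h.eigenvalues else 0

/-- The matrix `D²u(x,t)` of second derivatives in the space variable. -/
def spaceHessian {n : ℕ} (u : EuclideanSpace ℝ (Fin n) → ℝ → ℝ)
    (x : EuclideanSpace ℝ (Fin n)) (t : ℝ) : Matrix (Fin n) (Fin n) ℝ :=
  Matrix.of fun i j => iteratedFDeriv ℝ 2 (fun y => u y t) x
    ![EuclideanSpace.single i 1, EuclideanSpace.single j 1]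

/-- The gradient `Du(x,t)` in the space variable. -/
def spaceGradient {n : ℕ} (u : EuclideanSpace ℝ (Fin n) → ℝ → ℝ)
    (x : EuclideanSpace ℝ (Fin n)) (t : ℝ) : EuclideanSpace ℝ (Fin n) :=
  gradient (fun y => u y t) x

/-- The derivative `u_t(x,t)` of a function on (a part of) `ℝⁿ × (-∞,0]`; it is the two-sided
derivative for `t < 0` and the left derivative at `t = 0`. -/
def timeDeriv {n : ℕ} (u : EuclideanSpace ℝ (Fin n) → ℝ → ℝ) :
    EuclideanSpace ℝ (Fin n) → ℝ → ℝ :=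
  fun x t => derivWithin (fun s => u x s) (Iic 0) t

/-- The mixed derivative `D_x^i ∂_t^j u (x,t)`, as an `i`-linear form in the space directions. -/
def mixedDeriv {n : ℕ} (i j : ℕ) (u : EuclideanSpace ℝ (Fin n) → ℝ → ℝ)
    (p : EuclideanSpace ℝ (Fin n) × ℝ) :
    EuclideanSpace ℝ (Fin n) [×i]→L[ℝ] ℝ :=
  iteratedFDeriv ℝ i (fun y => timeDeriv^[j] u y p.2) p.1

/-- The parabolic class `C^{2m,m}(D)`, for `D` relatively open in `ℝⁿ × (-∞,0]`: all derivatives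
`D_x^i ∂_t^j u` with `i + 2j ≤ 2m` exist and are continuous on `D`. -/
structure ParabolicC {n : ℕ} (m : ℕ) (D : Set (EuclideanSpace ℝ (Fin n) × ℝ))
    (u : EuclideanSpace ℝ (Fin n) → ℝ → ℝ) : Prop where
  time_differentiable : ∀ j < m, ∀ p ∈ D,
    DifferentiableWithinAt ℝ (fun s => timeDeriv^[j] u p.1 s) (Iic 0) p.2
  space_contDiff : ∀ j ≤ m, ∀ p ∈ D,
    ContDiffAt ℝ ((2 * (m - j) : ℕ) : WithTop ℕ∞) (fun y => timeDeriv^[j] u y p.2) p.1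
  continuousOn : ∀ i j : ℕ, i + 2 * j ≤ 2 * m → ContinuousOn (mixedDeriv i j u) D

/-- The parabolic class `C^{2m,m}(closure of D)`: `u` is of class `C^{2m,m}(D)` and all
derivatives `D_x^i ∂_t^j u` with `i + 2j ≤ 2m` extend continuously to the closure of `D`. -/
structure ParabolicCClosure {n : ℕ} (m : ℕ) (D : Set (EuclideanSpace ℝ (Fin n) × ℝ))
    (u : EuclideanSpace ℝ (Fin n) → ℝ → ℝ) : Prop extends ParabolicC m D u where
  extends_closure : ∀ i j : ℕ, i + 2 * j ≤ 2 * m →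
    ∃ g : EuclideanSpace ℝ (Fin n) × ℝ → EuclideanSpace ℝ (Fin n) [×i]→L[ℝ] ℝ,
      ContinuousOn g (closure D) ∧ EqOn g (mixedDeriv i j u) D

/-- `u` is `k`-convex-monotone on `D`: the eigenvalues of `D²u` lie in the closure of `Γ_k`, and
`u` is decreasing in `t`. -/
structure KConvexMonotone {n : ℕ} (k : ℕ) (D : Set (EuclideanSpace ℝ (Fin n) × ℝ))
    (u : EuclideanSpace ℝ (Fin n) → ℝ → ℝ) : Prop where
  k_convex : ∀ p ∈ D, eigenvalueVector (spaceHessian u p.1 p.2) ∈ closure (Gam n k)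
  decreasing : ∀ x, AntitoneOn (fun t => u x t) {t | (x, t) ∈ D}

/-- `u` satisfies `-u_t σ_k(λ(D²u)) = ψ(x,t,u)` on `D`. -/
def IsSolution {n : ℕ} (k : ℕ) (D : Set (EuclideanSpace ℝ (Fin n) × ℝ))
    (ψ : EuclideanSpace ℝ (Fin n) → ℝ → ℝ → ℝ)
    (u : EuclideanSpace ℝ (Fin n) → ℝ → ℝ) : Prop :=
  ∀ p ∈ D, -timeDeriv u p.1 p.2 * sigma k (eigenvalueVector (spaceHessian u p.1 p.2)) =
    ψ p.1 p.2 (u p.1 p.2)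

/-- The domain `{(x,t) ∈ ℝⁿ × (-∞,0] : |x|² - r² < t}`. -/
def paraboloid (n : ℕ) (r : ℝ) : Set (EuclideanSpace ℝ (Fin n) × ℝ) :=
  {p | p.2 ≤ 0 ∧ ‖p.1‖ ^ 2 - r ^ 2 < p.2}

/-- `ψ(x,t,z)` is Lipschitz in `(x,z)` on `D × ℝ` for fixed `t`, with constant `L` with respect to
`max(|x - y|, |z - w|)`. As the dual of that norm is `|ξ| + |ζ|`, on a domain with convex time
slices this says exactly `|ψ_x| + |ψ_z| ≤ L` on `D × ℝ` (almost everywhere in `(x,z)`). -/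
def LipschitzInXZ {n : ℕ} (L : ℝ) (D : Set (EuclideanSpace ℝ (Fin n) × ℝ))
    (ψ : EuclideanSpace ℝ (Fin n) → ℝ → ℝ → ℝ) : Prop :=
  ∀ x y t z w, (x, t) ∈ D → (y, t) ∈ D →
    |ψ x t z - ψ y t w| ≤ L * max ‖x - y‖ |z - w|

end ParabolicHessian

end

/-! The proof is a Bernstein-type maximum principle argument for G = |Du| ρ / √(2U - u), where ρ = 1
- (|x|² - t)/r² vanishes on the parabolic boundary. Unless Du(0,0) = 0, G attains a positive maximum
in D (`exists_maximum`). At a maximum point put g = |Du|, ξ = Du/g, N = 2U - u. For this fixed ξ,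
u_ξ ≤ |Du| everywhere with equality at the point, so log u_ξ + log ρ - ½ log(2U - u) also has a
local maximum there, in space and backwards in time.

Either gρ ≤ KU/r, which is already the desired bound, or g is so large that the first order
condition contracted with ξ gives D²u(ξ,ξ) ≤ -g²/(12U). This negative direction compensates for the
possible degeneracy of the operator. In an eigenbasis of D²u with S_i = ∂σ_k/∂λ_i, it forces Σ ξ_i²
S_i ≥ σ_{k-1} (`sigma_le_sum_weight`), hence Σ S_i ≤ n Σ ξ_i² S_i, and also σ_{k-1} ≥
(-D²u(ξ,ξ)/n)^{k-1} ≥ 1 (`pow_le_sigma`). Both rest on Newton's inequality through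
`esymmOn_erase_pos`.

Now contract the second order conditions with S_i. The square root contributes a good term of order
(g²/U²) Σ ξ_i² S_i, which absorbs the cutoff errors of order (rρ)⁻² Σ S_i. The time condition
controls u_{tξ}, whose coefficient satisfies σ_k ≤ Ψ/m₁. Since the equation differentiated along ξ
has right side at least -L(1 + 2g), what remains is m₁g²/(288U²) ≤ L(1/g + 2)
(`gradient_bound_of_maximum_conditions`). This bounds g, and it is impossible when L = 0, which is
the case of constant ψ. Comparing G(0,0) with the maximum finishes the proof. -/

noncomputable section

namespace ParabolicHessian

/-! ### Newton's inequality and the cones Γ_k -/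

section

-- By Rolle's theorem the derivative has at most one root fewer than `p`, counted with multiplicity,
-- so it has as many roots as its degree.
open Polynomial in
theorem splits_derivative_real {p : ℝ[X]} (hp : p.Splits) : (derivative p).Splits := by
  rw [splits_iff_card_roots] at hp ⊢
  have h1 := card_roots_le_derivative p
  have h2 := card_roots' (derivative p)
  have h3 := natDegree_derivative_le p
  omega

open Polynomial in
/-- Laguerre's inequality at the origin. -/
theorem two_mul_coeff_le_sq_of_splits {p : ℝ[X]} (hp : p.Splits) :
    2 * (p.coeff 0 * p.coeff 2) ≤ p.coeff 1 ^ 2 := by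
  rw [hp.eq_prod_roots]
  generalize p.leadingCoeff = c
  induction p.roots using Multiset.induction_on with
  | empty => simp [coeff_C]
  | cons a s ih =>
    rw [Multiset.map_cons, Multiset.prod_cons, mul_left_comm (C c)]
    generalize C c * (Multiset.map (fun a => X - C a) s).prod = q at *
    simp only [sub_mul, coeff_sub, coeff_C_mul, coeff_X_mul, coeff_X_mul_zero]
    -- For (X - a)q the difference of the two sides is a²(q₁² - 2q₀q₂) + q₀².
    nlinarith [mul_nonneg (sq_nonneg a) (sub_nonneg.2 ih), sq_nonneg (q.coeff 0)]

open Polynomial in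
/-- Newton's inequality, without the binomial weights. -/
theorem coeff_mul_coeff_le_sq_of_splits {p : ℝ[X]} (hp : p.Splits) (j : ℕ) :
    p.coeff j * p.coeff (j + 2) ≤ p.coeff (j + 1) ^ 2 := by
  have hs : ∀ i, (derivative^[i] p).Splits := by
    intro i
    induction i with
    | zero => exact hp
    | succ i ih =>
      rw [Function.iterate_succ_apply']
      exact splits_derivative_real ih
  -- For the j-th derivative this reads (j+2) p_j p_{j+2} ≤ (j+1) p_{j+1}² after cancelling
  -- factorials, which is stronger than the claim when p_j p_{j+2} > 0.
  have h := two_mul_coeff_le_sq_of_splits (hs j)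
  simp only [coeff_iterate_derivative, nsmul_eq_mul, zero_add] at h
  rw [add_comm 1 j, add_comm 2 j] at h
  have e0 : j.descFactorial j = j.factorial := Nat.descFactorial_self j
  have e1 : (j + 1).descFactorial j = (j + 1) * j.factorial := by
    have := Nat.factorial_mul_descFactorial (show j ≤ j + 1 by omega)
    simpa [Nat.factorial_succ] using this
  have e2 : 2 * (j + 2).descFactorial j = (j + 2) * ((j + 1) * j.factorial) := by
    have := Nat.factorial_mul_descFactorial (show j ≤ j + 2 by omega)
    simpa [Nat.factorial_succ] using this
  have e2' : (2 : ℝ) * ((j + 2).descFactorial j : ℕ) = (j + 2) * ((j + 1) * j.factorial) := by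
    exact_mod_cast e2
  rw [e0, e1] at h
  push_cast at h
  have hf : (0 : ℝ) < j.factorial := by exact_mod_cast j.factorial_pos
  set F : ℝ := (j.factorial : ℝ)
  set a := p.coeff j
  set b := p.coeff (j + 1)
  set c := p.coeff (j + 2)
  have hj : (0 : ℝ) ≤ j := Nat.cast_nonneg j
  have h' : F ^ 2 * ((j + 2) * (j + 1) * (a * c)) ≤ F ^ 2 * ((j + 1) ^ 2 * b ^ 2) := by
    calc F ^ 2 * ((j + 2) * (j + 1) * (a * c)) = F * a * (((j + 2) * ((j + 1) * F)) * c) := by ring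
      _ = 2 * (F * a * (((j + 2).descFactorial j : ℕ) * c)) := by rw [← e2']; ring
      _ ≤ _ := h
      _ = _ := by ring
  have h2 := le_of_mul_le_mul_left h' (by positivity)
  have h3 : (j + 2 : ℝ) * (a * c) ≤ (j + 1) * b ^ 2 := by
    refine le_of_mul_le_mul_left (a := (j + 1 : ℝ)) ?_ (by positivity)
    linarith
  rcases le_or_gt (a * c) 0 with h0 | h0
  · exact h0.trans (sq_nonneg b)
  · refine le_of_mul_le_mul_left (a := (j + 1 : ℝ)) ?_ (by positivity)
    linarith

variable {ι : Type*}

/-- The `k`-th elementary symmetric function of the variables `lam i`, `i ∈ S`. -/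
def esymmOn (S : Finset ι) (k : ℕ) (lam : ι → ℝ) : ℝ :=
  ∑ s ∈ Finset.powersetCard k S, ∏ i ∈ s, lam i

@[simp] theorem esymmOn_zero (S : Finset ι) (lam : ι → ℝ) : esymmOn S 0 lam = 1 := by
  simp [esymmOn]

theorem esymmOn_eq_zero_of_card_lt {S : Finset ι} {k : ℕ} (h : S.card < k) (lam : ι → ℝ) :
    esymmOn S k lam = 0 := by
  simp [esymmOn, Finset.powersetCard_eq_empty.2 h]

theorem continuous_esymmOn (S : Finset ι) (k : ℕ) : Continuous (esymmOn S k) :=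
  continuous_finsetSum _ fun _ _ => continuous_finsetProd _ fun i _ => continuous_apply i

variable [DecidableEq ι]

theorem esymmOn_insert {S : Finset ι} {i : ι} (hi : i ∉ S) (k : ℕ) (lam : ι → ℝ) :
    esymmOn (insert i S) (k + 1) lam = esymmOn S (k + 1) lam + lam i * esymmOn S k lam := by
  unfold esymmOn
  rw [Finset.powersetCard_succ_insert hi, Finset.sum_union, Finset.sum_image, Finset.mul_sum]
  · congr 1
    refine Finset.sum_congr rfl fun s hs => ?_
    rw [Finset.prod_insert]
    exact fun h => hi ((Finset.mem_powersetCard.1 hs).1 h)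
  · intro s hs t ht hst
    have h1 : i ∉ s := fun h => hi ((Finset.mem_powersetCard.1 hs).1 h)
    have h2 : i ∉ t := fun h => hi ((Finset.mem_powersetCard.1 ht).1 h)
    rw [← Finset.erase_insert h1, ← Finset.erase_insert h2, hst]
  · rw [Finset.disjoint_left]
    intro s hs hs'
    obtain ⟨t, -, rfl⟩ := Finset.mem_image.1 hs'
    exact hi ((Finset.mem_powersetCard.1 hs).1 (Finset.mem_insert_self i t))

theorem esymmOn_erase {S : Finset ι} {i : ι} (hi : i ∈ S) (k : ℕ) (lam : ι → ℝ) :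
    esymmOn S (k + 1) lam =
      esymmOn (S.erase i) (k + 1) lam + lam i * esymmOn (S.erase i) k lam := by
  conv_lhs => rw [← Finset.insert_erase hi]
  exact esymmOn_insert (Finset.notMem_erase i S) k lam

theorem sum_esymmOn_erase (S : Finset ι) (k : ℕ) (lam : ι → ℝ) :
    ∑ i ∈ S, esymmOn (S.erase i) k lam = ((S.card : ℝ) - k) * esymmOn S k lam := by
  unfold esymmOn
  rw [Finset.sum_comm' (t' := Finset.powersetCard k S) (s' := fun s => S \ s), Finset.mul_sum]
  · refine Finset.sum_congr rfl fun s hs => ?_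
    obtain ⟨h1, h2⟩ := Finset.mem_powersetCard.1 hs
    rw [Finset.sum_const, nsmul_eq_mul, Finset.card_sdiff_of_subset h1, h2,
      Nat.cast_sub (h2 ▸ Finset.card_le_card h1)]
  · intro i s
    simp only [Finset.mem_powersetCard, Finset.mem_sdiff, Finset.subset_erase]
    tauto

theorem sum_mul_esymmOn_erase (S : Finset ι) (k : ℕ) (lam : ι → ℝ) :
    ∑ i ∈ S, lam i * esymmOn (S.erase i) k lam = (k + 1) * esymmOn S (k + 1) lam := by
  have h : ∀ i ∈ S, lam i * esymmOn (S.erase i) k lam =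
      esymmOn S (k + 1) lam - esymmOn (S.erase i) (k + 1) lam := fun i hi => by
    rw [esymmOn_erase hi]; ring
  rw [Finset.sum_congr rfl h, Finset.sum_sub_distrib, sum_esymmOn_erase, Finset.sum_const,
    nsmul_eq_mul]
  push_cast
  ring

open Polynomial in
theorem coeff_prod_one_add_C_mul_X (S : Finset ι) (k : ℕ) (lam : ι → ℝ) :
    (∏ i ∈ S, (1 + C (lam i) * X)).coeff k = esymmOn S k lam := by
  induction S using Finset.induction_on generalizing k with
  | empty =>
    cases k with
    | zero => simp
    | succ k => rw [esymmOn_eq_zero_of_card_lt (by simp)]; simp [coeff_one]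
  | insert i S hi ih =>
    rw [Finset.prod_insert hi, add_mul, one_mul, coeff_add, mul_assoc, coeff_C_mul, ih]
    cases k with
    | zero => simp
    | succ k => rw [coeff_X_mul, ih, esymmOn_insert hi]

open Polynomial in
/-- Newton's inequality for elementary symmetric functions of real numbers. -/
theorem esymmOn_mul_le_sq (S : Finset ι) (k : ℕ) (lam : ι → ℝ) :
    esymmOn S k lam * esymmOn S (k + 2) lam ≤ esymmOn S (k + 1) lam ^ 2 := by
  simp only [← coeff_prod_one_add_C_mul_X]
  refine coeff_mul_coeff_le_sq_of_splits (Splits.prod fun i _ => ?_) k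
  refine Splits.of_degree_le_one ?_
  rw [add_comm, ← C_1]
  exact degree_linear_le

/-- Deleting a variable maps Γ_{k+1} into Γ_k. At the first order where positivity fails, expanding
σ_{j+1} and σ_{j+2} in `lam i` gives a strict reversal of Newton's inequality for the remaining
variables. -/
theorem esymmOn_erase_pos {S : Finset ι} {k : ℕ} {lam : ι → ℝ}
    (h : ∀ j ≤ k + 1, 0 < esymmOn S j lam) {i : ι} (hi : i ∈ S) {j : ℕ} (hj : j ≤ k) :
    0 < esymmOn (S.erase i) j lam := by
  induction j with
  | zero => simp
  | succ j ih =>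
    have ih := ih (by omega)
    by_contra! hneg
    have h1 := h (j + 1) (by omega)
    have h2 := h (j + 2) (by omega)
    rw [esymmOn_erase hi] at h1 h2
    have hN := esymmOn_mul_le_sq (S.erase i) j lam
    set a := esymmOn (S.erase i) j lam
    set b := esymmOn (S.erase i) (j + 1) lam
    set c := esymmOn (S.erase i) (j + 2) lam
    -- Since -b ≥ 0 and `lam i` a > -b, also -`lam i` a b ≥ b². Hence ca > b², against `hN`.
    have hc : -(lam i * b) * a < c * a := mul_lt_mul_of_pos_right (by linarith) ih
    nlinarith [mul_nonneg (neg_nonneg.2 hneg) h1.le]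

theorem esymmOn_univ {n : ℕ} (k : ℕ) (lam : Fin n → ℝ) :
    esymmOn Finset.univ k lam = sigma k lam := rfl

theorem sigma_nonneg_of_mem_closure {n k : ℕ} {lam : Fin n → ℝ} (h : lam ∈ closure (Gam n k))
    {j : ℕ} (hj : j ≤ k) : 0 ≤ sigma j lam := by
  have hc : IsClosed {mu : Fin n → ℝ | 0 ≤ esymmOn Finset.univ j mu} :=
    isClosed_le continuous_const (continuous_esymmOn _ _)
  refine closure_minimal (fun mu hmu => ?_) hc h
  rcases Nat.eq_zero_or_pos j with rfl | h0
  · simp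
  · exact (hmu j h0 hj).le

theorem esymmOn_erase_nonneg_of_mem_closure {n k : ℕ} {lam : Fin n → ℝ}
    (h : lam ∈ closure (Gam n (k + 1))) (i : Fin n) {j : ℕ} (hj : j ≤ k) :
    0 ≤ esymmOn (Finset.univ.erase i) j lam := by
  have hc : IsClosed {mu : Fin n → ℝ | 0 ≤ esymmOn (Finset.univ.erase i) j mu} :=
    isClosed_le continuous_const (continuous_esymmOn _ _)
  refine closure_minimal (fun mu hmu => ?_) hc h
  refine (esymmOn_erase_pos (k := k) (fun l hl => ?_) (Finset.mem_univ i) hj).le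
  rcases Nat.eq_zero_or_pos l with rfl | h0
  · simp
  · exact hmu l h0 hl

/-! ### Weighted sums of the derivatives of σ_{k+1} -/

section weights

variable {n k : ℕ} {lam w : Fin n → ℝ}

/-- Expanding twice in λ_i, the deleted σ_{j+1} equals σ_{j+1} - λ_i σ_j plus λ_i² times the deleted
σ_{j-1}, and the last term is nonnegative on the closed cone. -/
theorem sigma_add_le_sum_weight (h : lam ∈ closure (Gam n (k + 1))) (hw : ∀ i, 0 ≤ w i)
    (hw1 : ∑ i, w i = 1) {j : ℕ} (hj : j + 1 ≤ k) :
    sigma (j + 1) lam - (∑ i, w i * lam i) * sigma j lam ≤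
      ∑ i, w i * esymmOn (Finset.univ.erase i) (j + 1) lam := by
  have key : ∀ i, w i * sigma (j + 1) lam - w i * lam i * sigma j lam ≤
      w i * esymmOn (Finset.univ.erase i) (j + 1) lam := by
    intro i
    rw [mul_assoc, ← mul_sub]
    refine mul_le_mul_of_nonneg_left ?_ (hw i)
    rw [← esymmOn_univ, ← esymmOn_univ, esymmOn_erase (Finset.mem_univ i) j]
    suffices lam i * esymmOn (Finset.univ.erase i) j lam ≤ lam i * esymmOn Finset.univ j lam by
      linarith
    cases j with
    | zero => simp
    | succ l =>
      rw [esymmOn_erase (Finset.mem_univ i) l]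
      have := esymmOn_erase_nonneg_of_mem_closure h i (j := l) (by omega)
      nlinarith [mul_nonneg (mul_self_nonneg (lam i)) this]
  calc _ = ∑ i, (w i * sigma (j + 1) lam - w i * lam i * sigma j lam) := by
        rw [Finset.sum_sub_distrib, ← Finset.sum_mul, ← Finset.sum_mul, hw1, one_mul]
    _ ≤ _ := Finset.sum_le_sum fun i _ => key i

theorem sum_weight_le (h : lam ∈ closure (Gam n (k + 1))) (hw : ∀ i, 0 ≤ w i)
    (hw1 : ∑ i, w i = 1) {j : ℕ} (hj : j ≤ k) :
    ∑ i, w i * esymmOn (Finset.univ.erase i) j lam ≤ n * sigma j lam := by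
  have h1 : ∀ i, w i ≤ 1 := fun i =>
    hw1 ▸ Finset.single_le_sum (fun l _ => hw l) (Finset.mem_univ i)
  calc _ ≤ ∑ i, esymmOn (Finset.univ.erase i) j lam := Finset.sum_le_sum fun i _ =>
        mul_le_of_le_one_left (esymmOn_erase_nonneg_of_mem_closure h i hj) (h1 i)
    _ = (n - j) * sigma j lam := by
        rw [sum_esymmOn_erase, Finset.card_univ, Fintype.card_fin, esymmOn_univ]
    _ ≤ _ := mul_le_mul_of_nonneg_right (by simp) (sigma_nonneg_of_mem_closure h (by omega))

/-- With a = -Σ w_i λ_i ≥ 0, the lower and upper bounds for the weighted sum give a σ_j ≤ n σ_{j+1},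
and this is iterated from σ_0 = 1. -/
theorem pow_le_sigma (h : lam ∈ closure (Gam n (k + 1))) (hw : ∀ i, 0 ≤ w i)
    (hw1 : ∑ i, w i = 1) (ha : ∑ i, w i * lam i ≤ 0) {j : ℕ} (hj : j ≤ k) :
    (-(∑ i, w i * lam i) / n) ^ j ≤ sigma j lam := by
  induction j with
  | zero => simp [← esymmOn_univ]
  | succ j ih =>
    have ih := ih (by omega)
    have h1 := sigma_add_le_sum_weight h hw hw1 hj
    have h2 := sum_weight_le h hw hw1 hj
    have h3 := sigma_nonneg_of_mem_closure h (j := j + 1) (by omega)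
    have hn : (0 : ℝ) < n := by
      rcases Nat.eq_zero_or_pos n with rfl | hn
      · simp at hw1
      · exact_mod_cast hn
    set a := -(∑ i, w i * lam i) with ha'
    have ha0 : 0 ≤ a := by linarith
    rw [pow_succ]
    calc (a / n) ^ j * (a / n) ≤ sigma j lam * (a / n) :=
          mul_le_mul_of_nonneg_right ih (by positivity)
      _ = (a * sigma j lam) / n := by ring
      _ ≤ sigma (j + 1) lam := by
          rw [div_le_iff₀ hn]; linarith

/-- If the quadratic form of `lam` is nonpositive at the unit vector with squared coordinates `w`,
then the coefficient of the linearized operator in this direction dominates its trace. -/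
theorem sigma_le_sum_weight (h : lam ∈ closure (Gam n (k + 1))) (hw : ∀ i, 0 ≤ w i)
    (hw1 : ∑ i, w i = 1) (ha : ∑ i, w i * lam i ≤ 0) :
    sigma k lam ≤ ∑ i, w i * esymmOn (Finset.univ.erase i) k lam := by
  cases k with
  | zero => simp [← esymmOn_univ, hw1]
  | succ k =>
    have h1 := sigma_add_le_sum_weight h hw hw1 le_rfl
    have h2 := sigma_nonneg_of_mem_closure h (j := k) (by omega)
    nlinarith [mul_nonneg (neg_nonneg.2 ha) h2]

end weights

end

/-! ### First variation of σ_{k+1}(λ(A)) -/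

section

open Matrix in
/-- At a diagonal matrix the determinant agrees to first order with the product of the diagonal
entries. -/
theorem hasDerivAt_det_sub_prod_diag {m : Type*} [Fintype m] [DecidableEq m]
    {M : ℝ → Matrix m m ℝ} {M' : Matrix m m ℝ} {x : ℝ}
    (hM : ∀ i j, HasDerivAt (fun s => M s i j) (M' i j) x) (hd : ∀ i j, i ≠ j → M x i j = 0) :
    HasDerivAt (fun s => (M s).det - ∏ i, M s i i) 0 x := by
  have h1 : (fun s => (M s).det - ∏ i, M s i i) = fun s =>
      ∑ g ∈ (Finset.univ.erase (1 : Equiv.Perm m)),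
        (Equiv.Perm.sign g : ℝ) * ∏ i, M s (g i) i := by
    funext s
    rw [det_apply', ← Finset.add_sum_erase _ _ (Finset.mem_univ (1 : Equiv.Perm m))]
    simp
  rw [h1]
  have h2 : ∀ g ∈ Finset.univ.erase (1 : Equiv.Perm m),
      HasDerivAt (fun s => (Equiv.Perm.sign g : ℝ) * ∏ i, M s (g i) i) 0 x := by
    intro g hg
    have h := (HasDerivAt.fun_finsetProd (u := Finset.univ) (f := fun i s => M s (g i) i)
      (f' := fun i => M' (g i) i) (x := x) fun i _ => hM (g i) i).const_mul
        (Equiv.Perm.sign g : ℝ)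
    refine h.congr_deriv ?_
    rw [Finset.sum_eq_zero, mul_zero]
    intro i _
    -- A nontrivial permutation moves at least two indices, so each of its products has two
    -- vanishing factors and one survives any single differentiation.
    obtain ⟨j, hj, hij⟩ : ∃ j, g j ≠ j ∧ j ≠ i := by
      by_contra! hcon
      refine (Finset.mem_erase.1 hg).1 (Equiv.ext fun j => ?_)
      by_contra hj
      have hji := hcon j hj
      subst hji
      exact hj (hcon (g j) fun h => hj (g.injective h))
    have h0 : ∏ l ∈ Finset.univ.erase i, M x (g l) l = 0 :=
      Finset.prod_eq_zero (Finset.mem_erase.2 ⟨hij, Finset.mem_univ j⟩) (hd _ _ hj)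
    rw [h0, zero_smul]
  simpa using HasDerivAt.fun_sum h2

theorem hasDerivAt_esymmOn {n k : ℕ} {μ : ℝ → Fin n → ℝ} {μ' : Fin n → ℝ} {x : ℝ}
    (h : ∀ i, HasDerivAt (fun s => μ s i) (μ' i) x) :
    HasDerivAt (fun s => sigma (k + 1) (μ s))
      (∑ i, esymmOn (Finset.univ.erase i) k (μ x) * μ' i) x := by
  have h1 := HasDerivAt.fun_sum (u := Finset.powersetCard (k + 1) (Finset.univ : Finset (Fin n)))
    fun s _ => HasDerivAt.fun_finsetProd (u := s) (f := fun i t => μ t i) (f' := μ') fun i _ => h i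
  refine h1.congr_deriv (Eq.symm ?_)
  simp only [esymmOn, Finset.sum_mul, smul_eq_mul]
  rw [Finset.sum_sigma', Finset.sum_sigma']
  -- Pairs (i, t) with i ∉ t, |t| = k correspond to pairs (s, i) with i ∈ s, |s| = k + 1, through s
  -- = t ∪ {i}.
  refine Finset.sum_bij' (fun p _ => ⟨insert p.1 p.2, p.1⟩) (fun p _ => ⟨p.2, p.1.erase p.2⟩)
    ?_ ?_ ?_ ?_ ?_
  · rintro ⟨i, t⟩ hp
    simp only [Finset.mem_sigma, Finset.mem_univ, Finset.mem_powersetCard, true_and,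
      Finset.subset_erase, Finset.subset_univ, Finset.mem_insert, true_or, and_true] at hp ⊢
    rw [Finset.card_insert_of_notMem hp.1, hp.2]
  · rintro ⟨s, i⟩ hp
    simp only [Finset.mem_sigma, Finset.mem_univ, Finset.mem_powersetCard, true_and,
      Finset.subset_erase, Finset.subset_univ, Finset.notMem_erase, not_false_eq_true] at hp ⊢
    rw [Finset.card_erase_of_mem hp.2, hp.1, Nat.add_sub_cancel]
  · rintro ⟨i, t⟩ hp
    simp only [Finset.mem_sigma, Finset.mem_powersetCard, Finset.subset_erase] at hp
    simp [Finset.erase_insert hp.2.1.2]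
  · rintro ⟨s, i⟩ hp
    simp [Finset.insert_erase (Finset.mem_sigma.1 hp).2]
  · rintro ⟨i, t⟩ hp
    simp only [Finset.mem_sigma, Finset.mem_powersetCard, Finset.subset_erase] at hp
    simp [Finset.erase_insert hp.2.1.2]

/-- The sum of the principal minors of order `k`. -/
def minorSum {n : ℕ} (k : ℕ) (A : Matrix (Fin n) (Fin n) ℝ) : ℝ :=
  ∑ s ∈ Finset.powersetCard k (Finset.univ : Finset (Fin n)),
    (A.submatrix (Subtype.val : s → Fin n) (Subtype.val : s → Fin n)).det

theorem minorSum_diagonal {n : ℕ} (k : ℕ) (d : Fin n → ℝ) :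
    minorSum k (Matrix.diagonal d) = sigma k d := by
  refine Finset.sum_congr rfl fun s _ => ?_
  rw [Matrix.submatrix_diagonal _ _ Subtype.val_injective, Matrix.det_diagonal]
  exact Finset.prod_coe_sort s d

-- The sum of principal minors is the coefficient of X^k in det(1 + XA), which is invariant under
-- conjugation.
open Polynomial in
theorem minorSum_conj {n : ℕ} (k : ℕ) {P Q : Matrix (Fin n) (Fin n) ℝ} (h : Q * P = 1)
    (A : Matrix (Fin n) (Fin n) ℝ) : minorSum k (Q * A * P) = minorSum k A := by
  unfold minorSum
  rw [← Matrix.coeff_det_one_add_X_smul_eq_sum_minors,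
    ← Matrix.coeff_det_one_add_X_smul_eq_sum_minors]
  congr 1
  have hQP : Q.map C * P.map C = (1 : Matrix (Fin n) (Fin n) ℝ[X]) := by
    rw [← Matrix.map_mul, h, Matrix.map_one _ C_0 C_1]
  have h1 : 1 + (X : ℝ[X]) • (Q * A * P).map C =
      Q.map C * (1 + (X : ℝ[X]) • A.map C) * P.map C := by
    rw [Matrix.mul_add, Matrix.add_mul, Matrix.mul_one, hQP, Matrix.mul_smul, Matrix.smul_mul,
      Matrix.map_mul, Matrix.map_mul]
  rw [h1, Matrix.det_mul, Matrix.det_mul, mul_right_comm, ← Matrix.det_mul, hQP, Matrix.det_one,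
    one_mul]

theorem hasDerivAt_minorSum {n k : ℕ} {M : ℝ → Matrix (Fin n) (Fin n) ℝ}
    {M' : Matrix (Fin n) (Fin n) ℝ} {x : ℝ}
    (hM : ∀ i j, HasDerivAt (fun s => M s i j) (M' i j) x) (hd : ∀ i j, i ≠ j → M x i j = 0) :
    HasDerivAt (fun s => minorSum (k + 1) (M s))
      (∑ i, esymmOn (Finset.univ.erase i) k (fun i => M x i i) * M' i i) x := by
  have h1 := HasDerivAt.fun_sum (u := Finset.powersetCard (k + 1) (Finset.univ : Finset (Fin n)))
    (A := fun s t => ((M t).submatrix (Subtype.val : s → Fin n) (Subtype.val : s → Fin n)).det -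
      ∏ i : s, M t i i) (A' := fun _ => 0) (x := x) fun s _ =>
    hasDerivAt_det_sub_prod_diag (M := fun t => (M t).submatrix (Subtype.val : s → Fin n)
      (Subtype.val : s → Fin n)) (M' := M'.submatrix Subtype.val Subtype.val)
      (fun i j => hM i j) (fun i j hij => hd i j fun h => hij (Subtype.ext h))
  have h2 := h1.add (hasDerivAt_esymmOn (k := k) (μ := fun t i => M t i i) fun i => hM i i)
  simp only [Finset.sum_const_zero, zero_add] at h2
  refine h2.congr_of_eventuallyEq (Filter.Eventually.of_forall fun t => ?_)
  simp only [Pi.add_apply, minorSum, sigma, Finset.sum_sub_distrib]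
  rw [eq_comm, sub_add_eq_add_sub, sub_eq_iff_eq_add, add_right_inj]
  exact Finset.sum_congr rfl fun s _ => (Finset.prod_coe_sort s fun i => M t i i).symm

section spectral

variable {n : ℕ} {A : Matrix (Fin n) (Fin n) ℝ}

open Matrix

theorem eigenvalueVector_eq (h : A.IsHermitian) : eigenvalueVector A = h.eigenvalues := by
  rw [eigenvalueVector, dif_pos h]

theorem star_eigenvectorUnitary_mul_self (h : A.IsHermitian) :
    (star (h.eigenvectorUnitary : Matrix (Fin n) (Fin n) ℝ)) *
      (h.eigenvectorUnitary : Matrix (Fin n) (Fin n) ℝ) = 1 :=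
  Unitary.coe_star_mul_self _

theorem star_mul_mul_eigenvectorUnitary (h : A.IsHermitian) :
    star (h.eigenvectorUnitary : Matrix (Fin n) (Fin n) ℝ) * A *
      (h.eigenvectorUnitary : Matrix (Fin n) (Fin n) ℝ) = diagonal h.eigenvalues := by
  have := h.conjStarAlgAut_star_eigenvectorUnitary
  rwa [Unitary.conjStarAlgAut_star_apply] at this

theorem sigma_eigenvalueVector (k : ℕ) (h : A.IsHermitian) :
    sigma k (eigenvalueVector A) = minorSum k A := by
  rw [eigenvalueVector_eq h, ← minorSum_diagonal, ← star_mul_mul_eigenvectorUnitary h,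
    minorSum_conj k (star_eigenvectorUnitary_mul_self h)]

theorem star_eigenvectorUnitary_mul_mul_apply (h : A.IsHermitian) (B : Matrix (Fin n) (Fin n) ℝ)
    (i j : Fin n) :
    (star (h.eigenvectorUnitary : Matrix (Fin n) (Fin n) ℝ) * B *
      (h.eigenvectorUnitary : Matrix (Fin n) (Fin n) ℝ)) i j =
    ∑ l, ∑ m, h.eigenvectorBasis i l * h.eigenvectorBasis j m * B l m := by
  simp only [mul_apply, star_apply, IsHermitian.eigenvectorUnitary_apply, star_trivial,
    Finset.sum_mul]
  rw [Finset.sum_comm]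
  refine Finset.sum_congr rfl fun l _ => Finset.sum_congr rfl fun m _ => ?_
  ring

theorem sum_eigenvectorBasis_mul (h : A.IsHermitian) (i j : Fin n) :
    ∑ l, ∑ m, h.eigenvectorBasis i l * h.eigenvectorBasis j m * A l m =
      if i = j then h.eigenvalues i else 0 := by
  rw [← star_eigenvectorUnitary_mul_mul_apply, star_mul_mul_eigenvectorUnitary, diagonal_apply]

/-- Single eigenvalues need not be differentiable where they cross, but their symmetric functions
are polynomials in the entries. Conjugating by the fixed eigenvector matrix of `B x` makes the
family diagonal at `x`, where only diagonal entries contribute to first order. -/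
theorem hasDerivAt_sigma_eigenvalueVector {k : ℕ} {B : ℝ → Matrix (Fin n) (Fin n) ℝ}
    {B' : Matrix (Fin n) (Fin n) ℝ} {x : ℝ} (hB : ∀ i j, HasDerivAt (fun s => B s i j) (B' i j) x)
    (hsymm : ∀ᶠ s in nhds x, (B s).IsHermitian) (h : (B x).IsHermitian) :
    HasDerivAt (fun s => sigma (k + 1) (eigenvalueVector (B s)))
      (∑ i, esymmOn (Finset.univ.erase i) k h.eigenvalues *
        ∑ l, ∑ m, h.eigenvectorBasis i l * h.eigenvectorBasis i m * B' l m) x := by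
  set P := (h.eigenvectorUnitary : Matrix (Fin n) (Fin n) ℝ) with hP
  have h1 : ∀ i j, HasDerivAt (fun s => (star P * B s * P) i j) ((star P * B' * P) i j) x := by
    intro i j
    simp only [hP, star_eigenvectorUnitary_mul_mul_apply]
    exact HasDerivAt.fun_sum fun l _ => HasDerivAt.fun_sum fun m _ => (hB l m).const_mul _
  have h2 := star_mul_mul_eigenvectorUnitary h
  have h3 := hasDerivAt_minorSum (k := k) h1 fun i j hij => by
    rw [hP, h2, diagonal_apply_ne _ hij]
  have h4 : (fun i => (star P * B x * P) i i) = h.eigenvalues := by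
    funext i
    rw [hP, h2, diagonal_apply_eq]
  rw [h4] at h3
  simp only [hP, star_eigenvectorUnitary_mul_mul_apply h B'] at h3
  refine h3.congr_of_eventuallyEq ?_
  filter_upwards [hsymm] with s hs
  rw [sigma_eigenvalueVector _ hs, minorSum_conj _ (star_eigenvectorUnitary_mul_self h)]

end spectral

end

/-! ### The algebra at a maximum point -/

section

theorem neg_add_sq_le (e q : ℝ) : (-(e + q)) ^ 2 ≤ 3 * e ^ 2 + 3 / 2 * q ^ 2 := by
  nlinarith [sq_nonneg (2 * e - q)]

set_option maxHeartbeats 800000 in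
/-- The algebraic part of the maximum principle argument: the first and second order conditions at
a maximum of `log |Du| + log ρ - log (M - u) / 2`, in an eigenbasis of the Hessian. -/
theorem gradient_bound_of_maximum_conditions {n k : ℕ} {lam ξ η T : Fin n → ℝ}
    {K U L Ψ r m₁ ρ N g τ v d : ℝ}
    (hlam : lam ∈ closure (Gam n (k + 1))) (hξ : ∑ i, ξ i ^ 2 = 1)
    (hη : ∑ i, η i ^ 2 ≤ 4 / r ^ 2) (hr : 0 < r) (hm : 0 < m₁) (hU : 0 < U) (hg : 0 < g)
    (hρ : 0 < ρ) (hρ1 : ρ ≤ 1) (hUN : U ≤ N) (hNU : N ≤ 3 * U) (hv : m₁ ≤ v)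
    (hUr : m₁ * r ^ 2 ≤ 4 * U)
    (first : ∀ i, lam i * ξ i / g + η i / ρ + g * ξ i / (2 * N) = 0)
    (second : ∀ i, T i / g - (lam i * ξ i / g) ^ 2 + -(2 / r ^ 2) / ρ - (η i / ρ) ^ 2 +
      lam i / (2 * N) + (g * ξ i) ^ 2 / (2 * N ^ 2) ≤ 0)
    (time : 0 ≤ τ / g + 1 / r ^ 2 / ρ - v / (2 * N))
    (hd : d = -τ * sigma (k + 1) lam + v * ∑ i, esymmOn (Finset.univ.erase i) k lam * T i)
    (hdL : |d| ≤ L * (1 + 2 * g)) (hΨ : v * sigma (k + 1) lam ≤ Ψ)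
    (hK : K * U / r ≤ g * ρ) (hK0 : 24 ≤ K) (hK1 : 2592 * n ≤ K ^ 2) (hK2 : 48 * n ≤ K ^ 2 * m₁)
    (hK3 : 288 * Ψ ≤ K ^ 2 * m₁ ^ 2) :
    m₁ * g ^ 2 / (288 * U ^ 2) ≤ L * (1 / g + 2) := by
  have hN : 0 < N := hU.trans_le hUN
  have hv0 : 0 < v := hm.trans_le hv
  set S : Fin n → ℝ := fun i => esymmOn (Finset.univ.erase i) k lam with hS
  have hS0 : ∀ i, 0 ≤ S i := fun i => esymmOn_erase_nonneg_of_mem_closure hlam i le_rfl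
  set σ := sigma (k + 1) lam with hσ
  have hσ0 : 0 ≤ σ := sigma_nonneg_of_mem_closure hlam le_rfl
  have hσk0 : 0 ≤ sigma k lam := sigma_nonneg_of_mem_closure hlam (by omega)
  have hw : ∀ i, 0 ≤ ξ i ^ 2 := fun i => sq_nonneg _
  -- All cutoff errors are multiples of y², and the assumption that g is large becomes KUy ≤ g.
  set y := 1 / (r * ρ) with hy
  have hy0 : 0 < y := by positivity
  have hKy : K * U * y ≤ g := by
    rw [hy, mul_one_div, div_le_iff₀ (by positivity)]
    rw [div_le_iff₀ hr] at hK
    linarith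
  have hyr : 1 / r ≤ y := by
    rw [hy]
    exact one_div_le_one_div_of_le (by positivity) (mul_le_of_le_one_right hr.le hρ1)
  have hyρ : 1 / r ^ 2 / ρ ≤ y ^ 2 := by
    rw [hy, div_div, one_div_pow]
    refine one_div_le_one_div_of_le (by positivity) ?_
    rw [mul_pow]
    exact mul_le_mul_of_nonneg_left (by nlinarith) (by positivity)
  have hη' : ∀ i, (η i / ρ) ^ 2 ≤ 4 * y ^ 2 := by
    intro i
    have h1 : η i ^ 2 ≤ 4 / r ^ 2 :=
      (Finset.single_le_sum (f := fun i => η i ^ 2) (fun j _ => sq_nonneg _)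
        (Finset.mem_univ i)).trans hη
    calc (η i / ρ) ^ 2 = η i ^ 2 / ρ ^ 2 := div_pow _ _ _
      _ ≤ 4 / r ^ 2 / ρ ^ 2 := by gcongr
      _ = 4 * y ^ 2 := by rw [hy]; field_simp
  have hKy2 : K ^ 2 * (U ^ 2 * y ^ 2) ≤ g ^ 2 := by
    have h0 : 0 ≤ K * U * y := by positivity
    calc K ^ 2 * (U ^ 2 * y ^ 2) = (K * U * y) ^ 2 := by ring
      _ ≤ g ^ 2 := pow_le_pow_left₀ h0 hKy 2
  -- the quadratic form is negative in the direction of the gradient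
  have hquad : g ^ 2 / (12 * U) ≤ -∑ i, ξ i ^ 2 * lam i := by
    have h1 : ∑ i, ξ i ^ 2 * lam i = -(g / ρ * ∑ i, ξ i * η i) - g ^ 2 / (2 * N) := by
      have h2 : ∀ i, ξ i ^ 2 * lam i = -(g / ρ * (ξ i * η i)) - g ^ 2 / (2 * N) * ξ i ^ 2 := by
        intro i
        have h3 : lam i * ξ i / g = -(η i / ρ) - g * ξ i / (2 * N) := by linarith [first i]
        rw [div_eq_iff hg.ne'] at h3
        calc ξ i ^ 2 * lam i = ξ i * (lam i * ξ i) := by ring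
          _ = _ := by rw [h3]; ring
      rw [Finset.sum_congr rfl fun i _ => h2 i, Finset.sum_sub_distrib, Finset.sum_neg_distrib,
        ← Finset.mul_sum, ← Finset.mul_sum, hξ, mul_one]
    have h4 : |∑ i, ξ i * η i| ≤ 2 / r := by
      refine abs_le_of_sq_le_sq ?_ (by positivity)
      calc (∑ i, ξ i * η i) ^ 2 ≤ (∑ i, ξ i ^ 2) * ∑ i, η i ^ 2 :=
            Finset.sum_mul_sq_le_sq_mul_sq _ _ _
        _ ≤ (2 / r) ^ 2 := by rw [hξ, one_mul, div_pow]; norm_num; exact hη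
    have h5 : -(2 * g * y) ≤ g / ρ * ∑ i, ξ i * η i := by
      calc -(2 * g * y) = g / ρ * -(2 / r) := by rw [hy]; field_simp
        _ ≤ _ := mul_le_mul_of_nonneg_left (abs_le.1 h4).1 (by positivity)
    have h6 : g ^ 2 / (6 * U) ≤ g ^ 2 / (2 * N) :=
      div_le_div_of_nonneg_left (sq_nonneg g) (by positivity) (by linarith)
    have h7 : 2 * g * y ≤ g ^ 2 / (12 * U) := by
      rw [le_div_iff₀ (by positivity)]
      have : 24 * U * y ≤ g := le_trans (by gcongr) hKy
      nlinarith
    have h8 : g ^ 2 / (6 * U) = g ^ 2 / (12 * U) + g ^ 2 / (12 * U) := by field_simp; norm_num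
    rw [h1]
    linarith
  have hneg : ∑ i, ξ i ^ 2 * lam i ≤ 0 := by
    have : 0 ≤ g ^ 2 / (12 * U) := by positivity
    linarith
  have hn : 0 < (n : ℝ) := by
    rcases Nat.eq_zero_or_pos n with rfl | hn
    · simp at hξ
    · exact_mod_cast hn
  set Q := ∑ i, ξ i ^ 2 * S i with hQ
  have hQσ : sigma k lam ≤ Q := sigma_le_sum_weight hlam hw hξ hneg
  have hQ1 : 1 ≤ Q := by
    refine le_trans ?_ ((pow_le_sigma hlam hw hξ hneg le_rfl).trans hQσ)
    -- It suffices that 12nU ≤ g². This follows from m₁r² ≤ 4U and 48n ≤ K²m₁, so no dependence on r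
    -- enters K.
    refine one_le_pow₀ ((one_le_div hn).2 (le_trans ?_ hquad))
    rw [le_div_iff₀ (by positivity)]
    have h1 : (1 / r) ^ 2 ≤ y ^ 2 := pow_le_pow_left₀ (by positivity) hyr 2
    have h2 : m₁ ≤ 4 * U * (1 / r) ^ 2 := by
      rw [one_div_pow, mul_one_div, le_div_iff₀ (by positivity)]
      exact hUr
    have h3 : m₁ ≤ 4 * U * y ^ 2 := h2.trans (by gcongr)
    calc n * (12 * U) = 48 * n * U / 4 := by ring
      _ ≤ K ^ 2 * m₁ * U / 4 := by gcongr
      _ ≤ K ^ 2 * (4 * U * y ^ 2) * U / 4 := by gcongr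
      _ = K ^ 2 * (U ^ 2 * y ^ 2) := by ring
      _ ≤ g ^ 2 := hKy2
  have htr : ∑ i, S i ≤ n * Q := by
    calc ∑ i, S i = (n - k) * sigma k lam := by
          rw [hS, sum_esymmOn_erase, Finset.card_univ, Fintype.card_fin, esymmOn_univ]
      _ ≤ n * sigma k lam := mul_le_mul_of_nonneg_right (by simp) hσk0
      _ ≤ n * Q := by gcongr
  -- By Euler's identity the sum is (k+1)σ_{k+1}, so the terms with λ_i/(2N) have a favourable sign.
  have heuler : 0 ≤ ∑ i, lam i * S i := by
    rw [hS, sum_mul_esymmOn_erase, esymmOn_univ]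
    positivity
  -- With e = η_i/ρ and q = gξ_i/(2N), the square (e+q)² costs at most 3e² + (3/2)q², while 2q² is
  -- available, so q²/2 is left. The cutoff errors are 4e² ≤ 16y² and 2/(r²ρ) ≤ 2y².
  have hT : ∀ i, T i / g ≤
      18 * y ^ 2 - 1 / (2 * N) * lam i - g ^ 2 / (72 * U ^ 2) * ξ i ^ 2 := by
    intro i
    have h1 : lam i * ξ i / g = -(η i / ρ + g * ξ i / (2 * N)) := by linarith [first i]
    have h2 := second i
    rw [h1] at h2
    set e := η i / ρ
    set q := g * ξ i / (2 * N) with hq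
    have h3 : (g * ξ i) ^ 2 / (2 * N ^ 2) = 2 * q ^ 2 := by rw [hq]; field_simp
    have h4 : g ^ 2 / (72 * U ^ 2) * ξ i ^ 2 ≤ q ^ 2 / 2 := by
      have : q ^ 2 / 2 = g ^ 2 / (8 * N ^ 2) * ξ i ^ 2 := by rw [hq]; field_simp; norm_num
      rw [this]
      refine mul_le_mul_of_nonneg_right ?_ (sq_nonneg _)
      refine div_le_div_of_nonneg_left (sq_nonneg g) (by positivity) ?_
      have := pow_le_pow_left₀ hN.le hNU 2
      linarith [mul_pow 3 U 2]
    have h5 : -(2 / r ^ 2) / ρ = -2 * (1 / r ^ 2 / ρ) := by ring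
    have h6 : lam i / (2 * N) = 1 / (2 * N) * lam i := by ring
    rw [h3, h5, h6] at h2
    linarith [hη' i, neg_add_sq_le e q, sq_nonneg y]
  have hsum : (∑ i, S i * T i) / g ≤ -(Q * (g ^ 2 / (144 * U ^ 2))) := by
    calc (∑ i, S i * T i) / g = ∑ i, S i * (T i / g) := by
          rw [Finset.sum_div]
          exact Finset.sum_congr rfl fun i _ => mul_div_assoc _ _ _
      _ ≤ ∑ i, S i * (18 * y ^ 2 - 1 / (2 * N) * lam i - g ^ 2 / (72 * U ^ 2) * ξ i ^ 2) :=
          Finset.sum_le_sum fun i _ => mul_le_mul_of_nonneg_left (hT i) (hS0 i)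
      _ = 18 * y ^ 2 * ∑ i, S i - 1 / (2 * N) * ∑ i, lam i * S i -
          g ^ 2 / (72 * U ^ 2) * Q := by
          rw [hQ, Finset.mul_sum, Finset.mul_sum, Finset.mul_sum, ← Finset.sum_sub_distrib,
            ← Finset.sum_sub_distrib]
          exact Finset.sum_congr rfl fun i _ => by ring
      _ ≤ 18 * y ^ 2 * (n * Q) - 0 - g ^ 2 / (72 * U ^ 2) * Q := by
          have : 0 ≤ 1 / (2 * N) * ∑ i, lam i * S i := by positivity
          gcongr
      _ = 18 * n * y ^ 2 * Q - 2 * (g ^ 2 / (144 * U ^ 2)) * Q := by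
          field_simp; ring
      _ ≤ g ^ 2 / (144 * U ^ 2) * Q - 2 * (g ^ 2 / (144 * U ^ 2)) * Q := by
          have : 18 * n * y ^ 2 ≤ g ^ 2 / (144 * U ^ 2) := by
            rw [le_div_iff₀ (by positivity)]
            calc 18 * n * y ^ 2 * (144 * U ^ 2) = 2592 * n * (U ^ 2 * y ^ 2) := by ring
              _ ≤ K ^ 2 * (U ^ 2 * y ^ 2) := by gcongr
              _ ≤ g ^ 2 := hKy2
          gcongr
      _ = _ := by ring
  -- This is the cost of the term with u_{tξ}, half of the good term; the condition 288Ψ ≤ K²m₁² is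
  -- chosen for it.
  have hσΨ : σ * y ^ 2 ≤ m₁ * (g ^ 2 / (288 * U ^ 2)) := by
    have h1 : m₁ * σ ≤ Ψ := (mul_le_mul_of_nonneg_right hv hσ0).trans hΨ
    rw [← mul_div_assoc, le_div_iff₀ (by positivity)]
    refine le_of_mul_le_mul_left ?_ hm
    calc m₁ * (σ * y ^ 2 * (288 * U ^ 2)) = 288 * (m₁ * σ) * (U ^ 2 * y ^ 2) := by ring
      _ ≤ 288 * Ψ * (U ^ 2 * y ^ 2) := by gcongr
      _ ≤ K ^ 2 * m₁ ^ 2 * (U ^ 2 * y ^ 2) := by gcongr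
      _ = m₁ ^ 2 * (K ^ 2 * (U ^ 2 * y ^ 2)) := by ring
      _ ≤ m₁ ^ 2 * g ^ 2 := by gcongr
      _ = _ := by ring
  have hdg : d / g ≤ -(m₁ * g ^ 2 / (288 * U ^ 2)) := by
    have h1 : -(τ / g) ≤ y ^ 2 := by
      have : 0 ≤ v / (2 * N) := by positivity
      linarith
    have h2 : v * ((∑ i, S i * T i) / g) ≤ -(m₁ * (g ^ 2 / (144 * U ^ 2))) := by
      have h3 : m₁ * (g ^ 2 / (144 * U ^ 2)) ≤ v * (Q * (g ^ 2 / (144 * U ^ 2))) := by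
        have h4 : (0 : ℝ) ≤ g ^ 2 / (144 * U ^ 2) := by positivity
        exact mul_le_mul hv (le_mul_of_one_le_left h4 hQ1) h4 hv0.le
      have := mul_le_mul_of_nonneg_left hsum hv0.le
      linarith
    calc d / g = -(τ / g) * σ + v * ((∑ i, S i * T i) / g) := by rw [hd]; ring
      _ ≤ y ^ 2 * σ + -(m₁ * (g ^ 2 / (144 * U ^ 2))) :=
          add_le_add (mul_le_mul_of_nonneg_right h1 hσ0) h2
      _ ≤ m₁ * (g ^ 2 / (288 * U ^ 2)) + -(m₁ * (g ^ 2 / (144 * U ^ 2))) := by linarith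
      _ = _ := by field_simp; norm_num
  have hdl : -(L * (1 / g + 2)) ≤ d / g := by
    rw [le_div_iff₀ hg]
    have h1 : -(L * (1 / g + 2)) * g = -(L * (1 + 2 * g)) := by field_simp
    rw [h1]
    exact (abs_le.1 hdL).1
  linarith

end

/-! ### Conditions at a maximum, and derivatives along lines -/

section

open Filter Topology

/-- A positive second derivative would make the point a local minimum as well, so the function would
be locally constant. -/
theorem second_deriv_nonpos_of_isLocalMax {g g' : ℝ → ℝ} {c x : ℝ}
    (hg : ∀ᶠ s in 𝓝 x, HasDerivAt g (g' s) s) (hg' : HasDerivAt g' c x) (hmax : IsLocalMax g x) :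
    c ≤ 0 := by
  by_contra! hc
  have h1 : deriv g =ᶠ[𝓝 x] g' := hg.mono fun s hs => hs.deriv
  have h0 : deriv g x = 0 := hmax.deriv_eq_zero
  have h2 : deriv (deriv g) x = c := by rw [h1.deriv_eq, hg'.deriv]
  have hmin := isLocalMin_of_deriv_deriv_pos (h2 ▸ hc) h0 hg.self_of_nhds.continuousAt
  have h3 : g =ᶠ[𝓝 x] fun _ => g x := by
    filter_upwards [hmax, hmin] with s hs1 hs2 using le_antisymm hs1 hs2
  have h4 : deriv (deriv g) x = 0 := by
    rw [h3.deriv.deriv_eq]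
    simp
  linarith

/-- The term b'²/(2(M - b)²) is twice the square of b'/(2(M - b)) in the first order condition. This
surplus, produced by the exponent ½, drives the estimate. -/
theorem maximum_conditions_of_isLocalMax_log {a a' b b' c c' : ℝ → ℝ} {a'' b'' c'' M : ℝ}
    (ha : ∀ᶠ s in 𝓝 0, HasDerivAt a (a' s) s) (ha' : HasDerivAt a' a'' 0) (ha0 : 0 < a 0)
    (hb : ∀ᶠ s in 𝓝 0, HasDerivAt b (b' s) s) (hb' : HasDerivAt b' b'' 0) (hb0 : 0 < M - b 0)
    (hc : ∀ᶠ s in 𝓝 0, HasDerivAt c (c' s) s) (hc' : HasDerivAt c' c'' 0) (hc0 : 0 < c 0)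
    (hmax : IsLocalMax
      (fun s => Real.log (a s) + Real.log (c s) - Real.log (M - b s) / 2) 0) :
    a' 0 / a 0 + c' 0 / c 0 + b' 0 / (2 * (M - b 0)) = 0 ∧
    a'' / a 0 - (a' 0 / a 0) ^ 2 + c'' / c 0 - (c' 0 / c 0) ^ 2 + b'' / (2 * (M - b 0)) +
      (b' 0) ^ 2 / (2 * (M - b 0) ^ 2) ≤ 0 := by
  have hpa : ∀ᶠ s in 𝓝 (0 : ℝ), 0 < a s :=
    ha.self_of_nhds.continuousAt.eventually (lt_mem_nhds ha0)
  have hpc : ∀ᶠ s in 𝓝 (0 : ℝ), 0 < c s :=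
    hc.self_of_nhds.continuousAt.eventually (lt_mem_nhds hc0)
  have hpb : ∀ᶠ s in 𝓝 (0 : ℝ), 0 < M - b s :=
    (hb.self_of_nhds.const_sub M).continuousAt.eventually (lt_mem_nhds hb0)
  have hg : ∀ᶠ s in 𝓝 (0 : ℝ),
      HasDerivAt (fun s => Real.log (a s) + Real.log (c s) - Real.log (M - b s) / 2)
        (a' s / a s + c' s / c s - -b' s / (M - b s) / 2) s := by
    filter_upwards [ha, hb, hc, hpa, hpb, hpc] with s h1 h2 h3 h4 h5 h6
    exact ((h1.log h4.ne').add (h3.log h6.ne')).sub (((h2.const_sub M).log h5.ne').div_const 2)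
  have hg' : HasDerivAt (fun s => a' s / a s + c' s / c s - -b' s / (M - b s) / 2)
      ((a'' * a 0 - a' 0 * a' 0) / a 0 ^ 2 + (c'' * c 0 - c' 0 * c' 0) / c 0 ^ 2 -
        (-b'' * (M - b 0) - -b' 0 * -b' 0) / (M - b 0) ^ 2 / 2) 0 :=
    ((ha'.div ha.self_of_nhds ha0.ne').add (hc'.div hc.self_of_nhds hc0.ne')).sub
      ((hb'.neg.div (hb.self_of_nhds.const_sub M) hb0.ne').div_const 2)
  constructor
  · have := hmax.hasDerivAt_eq_zero hg.self_of_nhds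
    refine Eq.trans ?_ this
    field_simp
    ring
  · have := second_deriv_nonpos_of_isLocalMax hg hg' hmax
    refine le_of_eq_of_le ?_ this
    field_simp
    ring

theorem nonneg_of_isLocalMaxOn_Iic {f : ℝ → ℝ} {f' x : ℝ} (hf : HasDerivWithinAt f f' (Iic x) x)
    (hmax : IsLocalMaxOn f (Iic x) x) : 0 ≤ f' := by
  have h := hmax.hasFDerivWithinAt_nonpos hf.hasFDerivWithinAt (y := -1) (by
    refine mem_posTangentConeAt_of_segment_subset ?_
    rw [segment_eq_uIcc]
    intro y hy
    rw [uIcc_of_ge (by linarith)] at hy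
    exact hy.2)
  simp at h
  exact h

theorem time_condition_of_isLocalMaxOn_log {a b c : ℝ → ℝ} {a' b' c' M t : ℝ}
    (ha : HasDerivWithinAt a a' (Iic t) t) (ha0 : 0 < a t)
    (hb : HasDerivWithinAt b b' (Iic t) t) (hb0 : 0 < M - b t)
    (hc : HasDerivWithinAt c c' (Iic t) t) (hc0 : 0 < c t)
    (hmax : IsLocalMaxOn
      (fun s => Real.log (a s) + Real.log (c s) - Real.log (M - b s) / 2) (Iic t) t) :
    0 ≤ a' / a t + c' / c t + b' / (2 * (M - b t)) := by
  have h := nonneg_of_isLocalMaxOn_Iic (((ha.log ha0.ne').add (hc.log hc0.ne')).sub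
    (((hb.const_sub M).log hb0.ne').div_const 2)) hmax
  refine h.trans_eq ?_
  field_simp
  ring

section lines

variable {E F : Type*} [NormedAddCommGroup E] [NormedSpace ℝ E] [NormedAddCommGroup F]
  [NormedSpace ℝ F]

theorem hasDerivAt_comp_line {f : E → F} {x e : E} {s : ℝ}
    (hf : DifferentiableAt ℝ f (x + s • e)) :
    HasDerivAt (fun s : ℝ => f (x + s • e)) (fderiv ℝ f (x + s • e) e) s := by
  have h1 : HasDerivAt (fun s : ℝ => x + s • e) e s := by
    simpa using ((hasDerivAt_id s).smul_const e).const_add x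
  exact hf.hasFDerivAt.comp_hasDerivAt s h1

theorem eventually_line {p : E → Prop} {x : E} (h : ∀ᶠ y in 𝓝 x, p y) (e : E) :
    ∀ᶠ s : ℝ in 𝓝 0, p (x + s • e) := by
  have h1 : Tendsto (fun s : ℝ => x + s • e) (𝓝 0) (𝓝 x) := by
    have : Continuous fun s : ℝ => x + s • e := by fun_prop
    simpa using this.tendsto 0
  exact h1.eventually h

variable {v : E → ℝ} {x : E}

theorem ContDiffAt.eventually_hasDerivAt_line {m : ℕ} {f : E → F}
    (hf : ContDiffAt ℝ ((m + 1 : ℕ) : WithTop ℕ∞) f x) (e : E) :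
    ∀ᶠ s : ℝ in 𝓝 0, HasDerivAt (fun s : ℝ => f (x + s • e)) (fderiv ℝ f (x + s • e) e) s := by
  have h1 := hf.eventually (by simp)
  filter_upwards [eventually_line h1 e] with s hs
  exact hasDerivAt_comp_line (hs.differentiableAt (by simp))

theorem fderiv_fderiv_symm (hv : ContDiffAt ℝ 2 v x) (a b : E) :
    fderiv ℝ (fderiv ℝ v) x a b = fderiv ℝ (fderiv ℝ v) x b a :=
  (hv.isSymmSndFDerivAt (by simp)) a b

theorem contDiffAt_fderiv {m : ℕ} {f : E → F}
    (hf : ContDiffAt ℝ ((m + 1 : ℕ) : WithTop ℕ∞) f x) :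
    ContDiffAt ℝ (m : WithTop ℕ∞) (fderiv ℝ f) x :=
  hf.fderiv_right (by norm_cast)

/-- The third derivative is symmetric. -/
theorem fderiv_fderiv_fderiv_comm (hv : ContDiffAt ℝ (3 : ℕ) v x) (a b : E) :
    fderiv ℝ (fderiv ℝ (fderiv ℝ v)) x a a b = fderiv ℝ (fderiv ℝ (fderiv ℝ v)) x b a a := by
  have h1 := contDiffAt_fderiv hv
  have h2 := contDiffAt_fderiv h1
  have hd : DifferentiableAt ℝ (fderiv ℝ (fderiv ℝ v)) x := h2.differentiableAt (by simp)
  have h3 : fderiv ℝ (fderiv ℝ (fderiv ℝ v)) x a a b =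
      fderiv ℝ (fderiv ℝ (fderiv ℝ v)) x a b a := by
    have e1 : ∀ p q : E, HasFDerivAt (fun y => fderiv ℝ (fderiv ℝ v) y p q)
        (((fderiv ℝ (fderiv ℝ (fderiv ℝ v)) x).flip p).flip q) x := fun p q => by
      have := (hd.hasFDerivAt.clm_apply (hasFDerivAt_const p x)).clm_apply (hasFDerivAt_const q x)
      refine this.congr_fderiv ?_
      ext z
      simp
    have e2 : (fun y => fderiv ℝ (fderiv ℝ v) y a b) =ᶠ[𝓝 x]
        fun y => fderiv ℝ (fderiv ℝ v) y b a := by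
      filter_upwards [hv.eventually (by simp)] with y hy
      exact fderiv_fderiv_symm (hy.of_le (by norm_cast)) a b
    have e3 := (e1 a b).unique ((e1 b a).congr_of_eventuallyEq e2)
    simpa using DFunLike.congr_fun e3 a
  rw [h3]
  have h4 := (h1.isSymmSndFDerivAt (n := 2) (by simp)) a b
  exact DFunLike.congr_fun h4 a

end lines

end

/-! ### Space and time derivatives on the paraboloid -/

section

open Filter Topology

variable {n : ℕ} {u : EuclideanSpace ℝ (Fin n) → ℝ → ℝ}

theorem exists_box_subset_paraboloid {r : ℝ} {x : EuclideanSpace ℝ (Fin n)} {t : ℝ}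
    (hp : (x, t) ∈ paraboloid n r) :
    ∃ δ > 0, ∀ y s, ‖y - x‖ < δ → t - δ < s → s ≤ t → (y, s) ∈ paraboloid n r := by
  have ho : IsOpen {p : EuclideanSpace ℝ (Fin n) × ℝ | ‖p.1‖ ^ 2 - r ^ 2 < p.2} :=
    isOpen_lt (by fun_prop) (by fun_prop)
  obtain ⟨δ, hδ, h⟩ := Metric.isOpen_iff.1 ho (x, t) hp.2
  refine ⟨δ, hδ, fun y s hy hs hst => ⟨hst.trans hp.1, ?_⟩⟩
  refine h (a := (y, s)) ?_
  rw [Metric.mem_ball, Prod.dist_eq, max_lt_iff, dist_eq_norm, Real.dist_eq, abs_lt]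
  exact ⟨hy, by simp only; linarith, by simp only; linarith⟩

theorem eventually_mem_paraboloid {r : ℝ} {x : EuclideanSpace ℝ (Fin n)} {t : ℝ}
    (hp : (x, t) ∈ paraboloid n r) : ∀ᶠ y in 𝓝 x, (y, t) ∈ paraboloid n r := by
  obtain ⟨δ, hδ, h⟩ := exists_box_subset_paraboloid hp
  filter_upwards [Metric.ball_mem_nhds x hδ] with y hy
  exact h y t (by rwa [← dist_eq_norm]) (by linarith) le_rfl

theorem spaceHessian_apply (x : EuclideanSpace ℝ (Fin n)) (t : ℝ) (i j : Fin n) :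
    spaceHessian u x t i j = fderiv ℝ (fderiv ℝ fun y => u y t) x
      (EuclideanSpace.single i 1) (EuclideanSpace.single j 1) := by
  simp [spaceHessian, iteratedFDeriv_two_apply]

theorem isHermitian_spaceHessian {x : EuclideanSpace ℝ (Fin n)} {t : ℝ}
    (h : ContDiffAt ℝ 2 (fun y => u y t) x) : (spaceHessian u x t).IsHermitian := by
  ext i j
  rw [Matrix.conjTranspose_apply, star_trivial, spaceHessian_apply, spaceHessian_apply]
  exact fderiv_fderiv_symm h _ _

theorem sum_mul_mul_bilin {B : EuclideanSpace ℝ (Fin n) →L[ℝ] EuclideanSpace ℝ (Fin n) →L[ℝ] ℝ}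
    (a b : EuclideanSpace ℝ (Fin n)) :
    ∑ l, ∑ m, a l * b m * B (EuclideanSpace.single l 1) (EuclideanSpace.single m 1) = B a b := by
  have h : ∀ c : EuclideanSpace ℝ (Fin n), c = ∑ l, c l • EuclideanSpace.single l (1 : ℝ) := by
    intro c
    simpa using ((EuclideanSpace.basisFun (Fin n) ℝ).sum_repr c).symm
  conv_rhs => rw [h a, h b]
  simp only [map_sum, map_smul, sum_apply, smul_apply,
    smul_eq_mul, Finset.mul_sum]
  rw [Finset.sum_comm]
  exact Finset.sum_congr rfl fun l _ => Finset.sum_congr rfl fun m _ => by ring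

theorem norm_spaceGradient (x : EuclideanSpace ℝ (Fin n)) (t : ℝ) :
    ‖spaceGradient u x t‖ = ‖mixedDeriv 1 0 u (x, t)‖ := by
  rw [mixedDeriv, norm_iteratedFDeriv_one, spaceGradient, gradient, LinearIsometryEquiv.norm_map]
  rfl

theorem fderiv_apply_eq_inner_spaceGradient (x ξ : EuclideanSpace ℝ (Fin n)) (t : ℝ) :
    fderiv ℝ (fun y => u y t) x ξ = inner ℝ (spaceGradient u x t) ξ := by
  rw [spaceGradient, gradient, InnerProductSpace.toDual_symm_apply]

theorem ParabolicC.continuousOn_self {m : ℕ} {D : Set (EuclideanSpace ℝ (Fin n) × ℝ)}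
    (hu : ParabolicC m D u) : ContinuousOn (fun p => u p.1 p.2) D := by
  have h := hu.continuousOn 0 0 (by omega)
  have h1 := (ContinuousMultilinearMap.apply ℝ (fun _ : Fin 0 => EuclideanSpace ℝ (Fin n)) ℝ
    ![]).continuous.comp_continuousOn h
  exact h1

theorem ParabolicC.continuousOn_norm_spaceGradient {m : ℕ}
    {D : Set (EuclideanSpace ℝ (Fin n) × ℝ)} (hu : ParabolicC (m + 1) D u) :
    ContinuousOn (fun p => ‖spaceGradient u p.1 p.2‖) D := by
  simp only [norm_spaceGradient]
  exact (hu.continuousOn 1 0 (by omega)).norm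

theorem ParabolicC.contDiffAt {m : ℕ} {D : Set (EuclideanSpace ℝ (Fin n) × ℝ)}
    (hu : ParabolicC m D u) {x : EuclideanSpace ℝ (Fin n)} {t : ℝ} (hp : (x, t) ∈ D) :
    ContDiffAt ℝ ((2 * m : ℕ) : WithTop ℕ∞) (fun y => u y t) x :=
  hu.space_contDiff 0 (Nat.zero_le _) (x, t) hp

theorem ParabolicC.hasDerivWithinAt {m : ℕ} {D : Set (EuclideanSpace ℝ (Fin n) × ℝ)}
    (hu : ParabolicC (m + 1) D u) {x : EuclideanSpace ℝ (Fin n)} {t : ℝ} (hp : (x, t) ∈ D) :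
    HasDerivWithinAt (fun s => u x s) (timeDeriv u x t) (Iic 0) t :=
  (hu.time_differentiable 0 (by omega) (x, t) hp).hasDerivWithinAt

/-- The derivatives in space and time of a function of class `C^{4,2}` commute. -/
theorem ParabolicC.hasDerivWithinAt_fderiv {r : ℝ} (hu : ParabolicC 2 (paraboloid n r) u)
    {x : EuclideanSpace ℝ (Fin n)} {t : ℝ} (hp : (x, t) ∈ paraboloid n r)
    (ξ : EuclideanSpace ℝ (Fin n)) :
    HasDerivWithinAt (fun s => fderiv ℝ (fun y => u y s) x ξ)
      (fderiv ℝ (fun y => timeDeriv u y t) x ξ) (Iic t) t := by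
  set c := fderiv ℝ (fun y => timeDeriv u y t) x ξ with hc
  have hcont : ContinuousOn (fun p : EuclideanSpace ℝ (Fin n) × ℝ =>
      fderiv ℝ (fun y => timeDeriv u y p.2) p.1 ξ) (paraboloid n r) := by
    have h := hu.continuousOn 1 1 (by norm_num)
    have h1 := (ContinuousMultilinearMap.apply ℝ (fun _ : Fin 1 => EuclideanSpace ℝ (Fin n)) ℝ
      ![ξ]).continuous.comp_continuousOn h
    refine h1.congr fun p _ => ?_
    simp [mixedDeriv]
  rw [hasDerivWithinAt_iff_isLittleO, Asymptotics.isLittleO_iff]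
  intro ε hε
  obtain ⟨δ₁, hδ₁, hbox⟩ := exists_box_subset_paraboloid hp
  obtain ⟨δ₂, hδ₂, hclose⟩ := Metric.continuousWithinAt_iff.1 (hcont (x, t) hp) ε hε
  set δ := min δ₁ δ₂
  have hδ : 0 < δ := lt_min hδ₁ hδ₂
  have hnear : ∀ᶠ s in 𝓝[Iic t] t, t - δ < s :=
    nhdsWithin_le_nhds (lt_mem_nhds (by linarith))
  filter_upwards [hnear, self_mem_nhdsWithin] with s hs hst
  have hst : s ≤ t := hst
  have hD : ∀ y τ, ‖y - x‖ < δ → τ ∈ Icc s t → (y, τ) ∈ paraboloid n r := fun y τ hy hτ =>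
    hbox y τ (hy.trans_le (min_le_left _ _)) (by linarith [hτ.1, min_le_left δ₁ δ₂]) hτ.2
  have hε' : ∀ y τ, ‖y - x‖ < δ → τ ∈ Icc s t →
      ‖fderiv ℝ (fun y => timeDeriv u y τ) y ξ - c‖ ≤ ε := by
    intro y τ hy hτ
    rw [← dist_eq_norm]
    refine (hclose (hD y τ hy hτ) ?_).le
    rw [Prod.dist_eq, max_lt_iff, dist_eq_norm, Real.dist_eq, abs_lt]
    have := min_le_right δ₁ δ₂
    exact ⟨hy.trans_le this, by simp only; linarith [hτ.1], by simp only; linarith [hτ.2]⟩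
  have hx : ‖x - x‖ < δ := by simpa using hδ
  -- Only D_x ∂_t u is known to be continuous, so the time increment of u_ξ is read off as the
  -- derivative at h = 0 of a difference in time. The mean value inequality, applied in h and then
  -- in τ, bounds the second difference by ε|h||s - t|.
  have hφ : HasDerivAt (fun h : ℝ => u (x + h • ξ) s - u (x + h • ξ) t - h * ((s - t) * c))
      (fderiv ℝ (fun y => u y s) x ξ - fderiv ℝ (fun y => u y t) x ξ - (s - t) * c) 0 := by
    have hdiff : ∀ τ ∈ Icc s t, HasDerivAt (fun h : ℝ => u (x + h • ξ) τ)
        (fderiv ℝ (fun y => u y τ) x ξ) 0 := by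
      intro τ hτ
      have h1 : DifferentiableAt ℝ (fun y => u y τ) (x + (0 : ℝ) • ξ) := by
        rw [zero_smul, add_zero]
        exact (hu.contDiffAt (hD x τ hx hτ)).differentiableAt (by norm_num)
      simpa using hasDerivAt_comp_line h1
    simpa using ((hdiff s ⟨le_rfl, hst⟩).fun_sub (hdiff t ⟨hst, le_rfl⟩)).fun_sub
      ((hasDerivAt_id (0 : ℝ)).mul_const ((s - t) * c))
  rw [smul_eq_mul]
  refine hφ.le_of_lip' (by positivity) ?_
  have hsmall : ∀ᶠ h : ℝ in 𝓝 0, ‖h • ξ‖ < δ := by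
    have : Continuous fun h : ℝ => ‖h • ξ‖ := by fun_prop
    exact this.continuousAt.eventually (gt_mem_nhds (by simpa using hδ))
  filter_upwards [hsmall] with h hh
  have hseg : ∀ h' ∈ uIcc 0 h, ‖x + h' • ξ - x‖ < δ := by
    intro h' hh'
    rw [add_sub_cancel_left]
    refine lt_of_le_of_lt ?_ hh
    rw [norm_smul, norm_smul]
    refine mul_le_mul_of_nonneg_right ?_ (norm_nonneg ξ)
    have := abs_sub_left_of_mem_uIcc hh'
    simpa using this
  have hinner : ∀ τ ∈ Icc s t,
      ‖timeDeriv u (x + h • ξ) τ - timeDeriv u x τ - h * c‖ ≤ ε * ‖h‖ := by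
    intro τ hτ
    have := Convex.norm_image_sub_le_of_norm_hasDerivWithin_le (C := ε) (s := uIcc 0 h)
      (f := fun h' : ℝ => timeDeriv u (x + h' • ξ) τ - h' * c)
      (f' := fun h' => fderiv ℝ (fun y => timeDeriv u y τ) (x + h' • ξ) ξ - c)
      (fun h' hh' => by
        have h1 := hasDerivAt_comp_line (f := fun y => timeDeriv u y τ) (x := x) (e := ξ)
          (s := h') ((hu.space_contDiff 1 (by norm_num) (x + h' • ξ, τ)
            (hD _ τ (hseg h' hh') hτ)).differentiableAt (by norm_num))
        simpa using (h1.fun_sub ((hasDerivAt_id h').mul_const c)).hasDerivWithinAt)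
      (fun h' hh' => hε' _ τ (hseg h' hh') hτ) (convex_uIcc 0 h) left_mem_uIcc right_mem_uIcc
    simpa [sub_right_comm] using this
  have hq := Convex.norm_image_sub_le_of_norm_hasDerivWithin_le (C := ε * ‖h‖) (s := Icc s t)
    (f := fun τ : ℝ => u (x + h • ξ) τ - u x τ - h * (τ * c))
    (f' := fun τ => timeDeriv u (x + h • ξ) τ - timeDeriv u x τ - h * c)
    (fun τ hτ => by
      have h0 : Icc s t ⊆ Iic 0 := fun τ' hτ' => hτ'.2.trans hp.1
      have h1 := (hu.hasDerivWithinAt (hD _ τ (hseg h right_mem_uIcc) hτ)).mono h0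
      have h2 := (hu.hasDerivWithinAt (hD x τ hx hτ)).mono h0
      simpa using (h1.fun_sub h2).fun_sub
        ((((hasDerivAt_id τ).mul_const c).const_mul h).hasDerivWithinAt (s := Icc s t)))
    (fun τ hτ => hinner τ hτ) (convex_Icc s t) (right_mem_Icc.2 hst) (left_mem_Icc.2 hst)
  calc _ = ‖u (x + h • ξ) s - u x s - h * (s * c) - (u (x + h • ξ) t - u x t - h * (t * c))‖ := by
        congr 1
        simp only [zero_smul, add_zero, zero_mul]
        ring
    _ ≤ ε * ‖h‖ * ‖s - t‖ := hq
    _ = _ := by rw [sub_zero]; ring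

end

/-! ### The cutoff and the gradient bound at a maximum point -/

section

open Filter Topology

/-- The cutoff function that vanishes on the parabolic boundary of the paraboloid. -/
def cutoff {n : ℕ} (r : ℝ) (x : EuclideanSpace ℝ (Fin n)) (t : ℝ) : ℝ :=
  1 - (‖x‖ ^ 2 - t) / r ^ 2

theorem mem_paraboloid_iff {n : ℕ} {r : ℝ} (hr : 0 < r) {x : EuclideanSpace ℝ (Fin n)} {t : ℝ} :
    (x, t) ∈ paraboloid n r ↔ t ≤ 0 ∧ 0 < cutoff r x t := by
  unfold paraboloid cutoff
  rw [sub_pos, div_lt_one (by positivity)]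
  simp only [mem_ofPred_eq]
  exact and_congr_right fun _ => ⟨fun h => by linarith, fun h => by linarith⟩

theorem cutoff_le_one {n : ℕ} (r : ℝ) (x : EuclideanSpace ℝ (Fin n)) {t : ℝ} (ht : t ≤ 0) :
    cutoff r x t ≤ 1 := by
  have : 0 ≤ (‖x‖ ^ 2 - t) / r ^ 2 := div_nonneg (by nlinarith [sq_nonneg ‖x‖]) (sq_nonneg r)
  unfold cutoff
  linarith

theorem hasDerivAt_cutoff_line {n : ℕ} (r : ℝ) (x e : EuclideanSpace ℝ (Fin n)) (t s : ℝ)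
    (he : ‖e‖ = 1) : HasDerivAt (fun s : ℝ => cutoff r (x + s • e) t)
      (-(2 * inner ℝ x e + 2 * s) / r ^ 2) s := by
  have h : (fun s : ℝ => cutoff r (x + s • e) t) = fun s =>
      1 - (‖x‖ ^ 2 + 2 * inner ℝ x e * s + s ^ 2 - t) / r ^ 2 := by
    funext s
    rw [cutoff, norm_add_sq_real, inner_smul_right, norm_smul, he, mul_one, Real.norm_eq_abs,
      sq_abs]
    ring
  rw [h]
  have h1 := (((((hasDerivAt_id s).const_mul (2 * inner ℝ x e)).const_add (‖x‖ ^ 2)).fun_add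
    ((hasDerivAt_id s).fun_pow 2)).sub_const t).div_const (r ^ 2) |>.const_sub 1
  refine h1.congr_deriv ?_
  simp
  ring

theorem hasDerivWithinAt_cutoff_time {n : ℕ} (r : ℝ) (x : EuclideanSpace ℝ (Fin n)) (t : ℝ)
    (s : Set ℝ) : HasDerivWithinAt (fun t => cutoff r x t) (1 / r ^ 2) s t := by
  have h1 := (((hasDerivAt_id t).const_sub (‖x‖ ^ 2)).div_const (r ^ 2)).const_sub 1
  refine (h1.congr_deriv ?_).hasDerivWithinAt
  ring

theorem log_add_log_sub_le {a G ρ N g ρ₀ N₀ : ℝ} (ha : 0 < a) (haG : a ≤ G) (hρ : 0 < ρ)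
    (hN : 0 < N) (hg : 0 < g) (hρ₀ : 0 < ρ₀) (hN₀ : 0 < N₀)
    (h : G * ρ / √N ≤ g * ρ₀ / √N₀) :
    Real.log a + Real.log ρ - Real.log N / 2 ≤ Real.log g + Real.log ρ₀ - Real.log N₀ / 2 := by
  have hs := Real.sqrt_pos.2 hN
  have hs₀ := Real.sqrt_pos.2 hN₀
  rw [← Real.log_sqrt hN.le, ← Real.log_sqrt hN₀.le, ← Real.log_mul ha.ne' hρ.ne',
    ← Real.log_mul hg.ne' hρ₀.ne', ← Real.log_div (by positivity) hs.ne',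
    ← Real.log_div (by positivity) hs₀.ne']
  refine Real.log_le_log (by positivity) (le_trans ?_ h)
  gcongr

theorem inner_le_norm_of_norm_eq_one {n : ℕ} (a : EuclideanSpace ℝ (Fin n))
    {ξ : EuclideanSpace ℝ (Fin n)} (hξ : ‖ξ‖ = 1) : inner ℝ a ξ ≤ ‖a‖ := by
  simpa [hξ] using real_inner_le_norm a ξ

theorem OrthonormalBasis.sum_sq_inner {n : ℕ}
    (e : OrthonormalBasis (Fin n) ℝ (EuclideanSpace ℝ (Fin n))) (a : EuclideanSpace ℝ (Fin n)) :
    ∑ i, inner ℝ (e i) a ^ 2 = ‖a‖ ^ 2 := by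
  simpa using e.sum_sq_norm_inner_right a

/-- No differentiability of ψ in x and z is needed: near 0 the increment of u along ξ is at most
2g|s|, and the Lipschitz bound passes to the derivative of the composition. -/
theorem norm_deriv_rhs_le {n : ℕ} {r L g d : ℝ} {ψ : EuclideanSpace ℝ (Fin n) → ℝ → ℝ → ℝ}
    {u : EuclideanSpace ℝ (Fin n) → ℝ → ℝ} {x ξ : EuclideanSpace ℝ (Fin n)} {t : ℝ}
    (hψ : LipschitzInXZ L (paraboloid n r) ψ) (hL : 0 ≤ L) (hg : 0 < g) (hξ : ‖ξ‖ = 1)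
    (hp : (x, t) ∈ paraboloid n r) (hu : HasDerivAt (fun s : ℝ => u (x + s • ξ) t) g 0)
    (hd : HasDerivAt (fun s : ℝ => ψ (x + s • ξ) t (u (x + s • ξ) t)) d 0) :
    |d| ≤ L * (1 + 2 * g) := by
  refine hd.le_of_lip' (by positivity) ?_
  have h1 : ∀ᶠ s : ℝ in 𝓝 0, ‖u (x + s • ξ) t - u (x + (0 : ℝ) • ξ) t - (s - 0) • g‖ ≤
      g * ‖s - 0‖ := (Asymptotics.isLittleO_iff.1 hu.isLittleO) hg
  filter_upwards [eventually_line (eventually_mem_paraboloid hp) ξ, h1] with s hs hs1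
  have h2 := hψ (x + s • ξ) (x + (0 : ℝ) • ξ) t (u (x + s • ξ) t) (u (x + (0 : ℝ) • ξ) t) hs
    (by simpa using hp)
  refine h2.trans ?_
  rw [mul_assoc]
  refine mul_le_mul_of_nonneg_left (max_le ?_ ?_) hL
  · rw [add_sub_add_left_eq_sub, ← sub_smul, norm_smul, hξ, mul_one]
    exact le_mul_of_one_le_left (norm_nonneg _) (by linarith)
  · have h3 : |u (x + s • ξ) t - u (x + (0 : ℝ) • ξ) t| ≤ g * ‖s - 0‖ + ‖(s - 0) • g‖ := by
      have := norm_add_le (u (x + s • ξ) t - u (x + (0 : ℝ) • ξ) t - (s - 0) • g) ((s - 0) • g)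
      rw [sub_add_cancel] at this
      exact this.trans (by gcongr)
    rw [norm_smul, Real.norm_of_nonneg hg.le] at h3
    nlinarith [norm_nonneg (s - 0)]

theorem fderiv_fderiv_eigenvectorBasis {n : ℕ} {u : EuclideanSpace ℝ (Fin n) → ℝ → ℝ}
    {x : EuclideanSpace ℝ (Fin n)} {t : ℝ} (hH : (spaceHessian u x t).IsHermitian) (i j : Fin n) :
    fderiv ℝ (fderiv ℝ fun y => u y t) x (hH.eigenvectorBasis i) (hH.eigenvectorBasis j) =
      if i = j then hH.eigenvalues i else 0 := by
  rw [← sum_eigenvectorBasis_mul hH i j, ← sum_mul_mul_bilin]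
  simp only [spaceHessian_apply]

/-- The derivative of `σ_k(λ(D²u))` along a line in an eigenbasis of the Hessian. -/
theorem hasDerivAt_sigma_spaceHessian {n k : ℕ} {r : ℝ} {u : EuclideanSpace ℝ (Fin n) → ℝ → ℝ}
    (hu : ParabolicC 2 (paraboloid n r) u) {x : EuclideanSpace ℝ (Fin n)} {t : ℝ}
    (hp : (x, t) ∈ paraboloid n r) (hH : (spaceHessian u x t).IsHermitian)
    (ξ : EuclideanSpace ℝ (Fin n)) :
    HasDerivAt (fun s : ℝ => sigma (k + 1) (eigenvalueVector (spaceHessian u (x + s • ξ) t)))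
      (∑ i, esymmOn (Finset.univ.erase i) k hH.eigenvalues *
        fderiv ℝ (fderiv ℝ (fderiv ℝ fun y => u y t)) x ξ (hH.eigenvectorBasis i)
          (hH.eigenvectorBasis i)) 0 := by
  have hx0 : x + (0 : ℝ) • ξ = x := by rw [zero_smul, add_zero]
  have hB : ∀ i j, HasDerivAt (fun s : ℝ => spaceHessian u (x + s • ξ) t i j)
      (fderiv ℝ (fderiv ℝ (fderiv ℝ fun y => u y t)) x ξ (EuclideanSpace.single i 1)
        (EuclideanSpace.single j 1)) 0 := by
    intro i j
    simp only [spaceHessian_apply]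
    have := ((ContDiffAt.eventually_hasDerivAt_line (contDiffAt_fderiv (contDiffAt_fderiv (m := 2 + 1)
      (hu.contDiffAt hp))) ξ).self_of_nhds.clm_apply
      (hasDerivAt_const (0 : ℝ) (EuclideanSpace.single i (1 : ℝ)))).clm_apply
      (hasDerivAt_const (0 : ℝ) (EuclideanSpace.single j (1 : ℝ)))
    simpa only [map_zero, add_zero, zero_smul] using this
  have hsymm : ∀ᶠ s : ℝ in 𝓝 0, (spaceHessian u (x + s • ξ) t).IsHermitian := by
    filter_upwards [eventually_line (eventually_mem_paraboloid hp) ξ] with s hs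
    exact isHermitian_spaceHessian ((hu.contDiffAt hs).of_le (by norm_num))
  -- The chosen eigenbasis depends on the matrix, so it is transported from x + 0·ξ to x by
  -- generalizing over the matrix.
  have key : ∀ (A : Matrix (Fin n) (Fin n) ℝ) (hA : A.IsHermitian)
      (hA0 : spaceHessian u (x + (0 : ℝ) • ξ) t = A), HasDerivAt
      (fun s : ℝ => sigma (k + 1) (eigenvalueVector (spaceHessian u (x + s • ξ) t)))
      (∑ i, esymmOn (Finset.univ.erase i) k hA.eigenvalues *
        ∑ l, ∑ m, hA.eigenvectorBasis i l * hA.eigenvectorBasis i m *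
          fderiv ℝ (fderiv ℝ (fderiv ℝ fun y => u y t)) x ξ (EuclideanSpace.single l 1)
            (EuclideanSpace.single m 1)) 0 := by
    rintro A hA rfl
    exact hasDerivAt_sigma_eigenvalueVector (B' := Matrix.of fun i j =>
      fderiv ℝ (fderiv ℝ (fderiv ℝ fun y => u y t)) x ξ (EuclideanSpace.single i 1)
        (EuclideanSpace.single j 1)) hB hsymm hA
  have h := key _ hH (by rw [hx0])
  simpa only [sum_mul_mul_bilin] using h

set_option maxHeartbeats 400000 in
theorem gradient_bound_at_maximum {n k : ℕ} {r m₁ U L Ψ K : ℝ}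
    {ψ : EuclideanSpace ℝ (Fin n) → ℝ → ℝ → ℝ} {u : EuclideanSpace ℝ (Fin n) → ℝ → ℝ}
    (hr : 0 < r) (hm : 0 < m₁) (hU : 0 < U) (hL : 0 ≤ L) (hUr : m₁ * r ^ 2 ≤ 4 * U)
    (hψΨ : ∀ p ∈ paraboloid n r, ∀ z, ψ p.1 p.2 z ≤ Ψ)
    (hψL : LipschitzInXZ L (paraboloid n r) ψ) (hu : ParabolicC 2 (paraboloid n r) u)
    (hconv : ∀ p ∈ paraboloid n r,
      eigenvalueVector (spaceHessian u p.1 p.2) ∈ closure (Gam n (k + 1)))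
    (hsol : IsSolution (k + 1) (paraboloid n r) ψ u)
    (hut : ∀ p ∈ paraboloid n r, m₁ ≤ -timeDeriv u p.1 p.2)
    (huU : ∀ p ∈ paraboloid n r, |u p.1 p.2| ≤ U)
    {x : EuclideanSpace ℝ (Fin n)} {t : ℝ} (hp : (x, t) ∈ paraboloid n r)
    (hmax : ∀ q ∈ paraboloid n r,
      ‖spaceGradient u q.1 q.2‖ * cutoff r q.1 q.2 / √(2 * U - u q.1 q.2) ≤
        ‖spaceGradient u x t‖ * cutoff r x t / √(2 * U - u x t))
    (hg : 0 < ‖spaceGradient u x t‖) (hK : K * U / r ≤ ‖spaceGradient u x t‖ * cutoff r x t)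
    (hK0 : 24 ≤ K) (hK1 : 2592 * n ≤ K ^ 2) (hK2 : 48 * n ≤ K ^ 2 * m₁)
    (hK3 : 288 * Ψ ≤ K ^ 2 * m₁ ^ 2) :
    m₁ * ‖spaceGradient u x t‖ ^ 2 / (288 * U ^ 2) ≤
      L * (1 / ‖spaceGradient u x t‖ + 2) := by
  set g := ‖spaceGradient u x t‖ with hgdef
  -- The direction ξ is frozen from here on, so that the linear quantity u_ξ replaces |Du| in the
  -- differentiation.
  obtain ⟨ξ, hξ, hgξ⟩ : ∃ ξ : EuclideanSpace ℝ (Fin n), ‖ξ‖ = 1 ∧ spaceGradient u x t = g • ξ :=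
    ⟨g⁻¹ • spaceGradient u x t, by rw [norm_smul, norm_inv, norm_norm, ← hgdef,
      inv_mul_cancel₀ hg.ne'], by rw [smul_inv_smul₀ hg.ne']⟩
  clear_value g
  set v : EuclideanSpace ℝ (Fin n) → ℝ := fun y => u y t with hv
  have hv4 : ContDiffAt ℝ ((3 + 1 : ℕ) : WithTop ℕ∞) v x := hu.contDiffAt hp
  have hv3 : ContDiffAt ℝ ((2 + 1 : ℕ) : WithTop ℕ∞) (fderiv ℝ v) x := contDiffAt_fderiv hv4
  have hv2 : ContDiffAt ℝ ((1 + 1 : ℕ) : WithTop ℕ∞) (fderiv ℝ (fderiv ℝ v)) x :=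
    contDiffAt_fderiv hv3
  have hH := isHermitian_spaceHessian (u := u) (t := t) (hv4.of_le (by norm_cast))
  have hDv : ∀ e, fderiv ℝ v x e = g * inner ℝ e ξ := fun e => by
    rw [hv, fderiv_apply_eq_inner_spaceGradient, hgξ, real_inner_smul_left, real_inner_comm]
  have hpos : ∀ q ∈ paraboloid n r, 0 < 2 * U - u q.1 q.2 := fun q hq => by
    have := (abs_le.1 (huU q hq)).2
    linarith
  have hN := hpos _ hp
  have hρ : 0 < cutoff r x t := ((mem_paraboloid_iff hr).1 hp).2
  set e := hH.eigenvectorBasis with he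
  have he1 : ∀ i, ‖e i‖ = 1 := fun i => e.orthonormal.1 i
  set lam := hH.eigenvalues with hlam
  have hD2 : ∀ i j, fderiv ℝ (fderiv ℝ v) x (e i) (e j) = if i = j then lam i else 0 := by
    intro i j
    exact fderiv_fderiv_eigenvectorBasis hH i j
  have hD2ξ : ∀ i, fderiv ℝ (fderiv ℝ v) x (e i) ξ = lam i * inner ℝ (e i) ξ := by
    intro i
    conv_lhs => rw [← e.sum_repr' ξ]
    simp only [map_sum, map_smul, hD2, smul_eq_mul]
    rw [Finset.sum_eq_single i (fun j _ hj => by rw [if_neg hj.symm, mul_zero])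
      (fun h => absurd (Finset.mem_univ i) h), if_pos rfl, mul_comm]
  have hgrad : ∀ y s, (y, s) ∈ paraboloid n r → 0 < fderiv ℝ (fun z => u z s) y ξ →
      Real.log (fderiv ℝ (fun z => u z s) y ξ) + Real.log (cutoff r y s) -
        Real.log (2 * U - u y s) / 2 ≤
      Real.log g + Real.log (cutoff r x t) - Real.log (2 * U - u x t) / 2 := by
    intro y s hy ha
    have haG : fderiv ℝ (fun z => u z s) y ξ ≤ ‖spaceGradient u y s‖ := by
      rw [fderiv_apply_eq_inner_spaceGradient]
      exact inner_le_norm_of_norm_eq_one _ hξ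
    exact log_add_log_sub_le ha haG ((mem_paraboloid_iff hr).1 hy).2 (hpos (y, s) hy) hg hρ hN
      (hmax (y, s) hy)
  have hDξ : fderiv ℝ v x ξ = g := by
    rw [hDv, real_inner_self_eq_norm_sq, hξ, one_pow, mul_one]
  have hspace : ∀ i,
      lam i * inner ℝ (e i) ξ / g + -(2 * inner ℝ x (e i)) / r ^ 2 / cutoff r x t +
        g * inner ℝ (e i) ξ / (2 * (2 * U - u x t)) = 0 ∧
      fderiv ℝ (fderiv ℝ (fderiv ℝ v)) x ξ (e i) (e i) / g - (lam i * inner ℝ (e i) ξ / g) ^ 2 +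
        -(2 / r ^ 2) / cutoff r x t - (-(2 * inner ℝ x (e i)) / r ^ 2 / cutoff r x t) ^ 2 +
        lam i / (2 * (2 * U - u x t)) +
        (g * inner ℝ (e i) ξ) ^ 2 / (2 * (2 * U - u x t) ^ 2) ≤ 0 := by
    intro i
    have ha1 := (ContDiffAt.eventually_hasDerivAt_line hv3 (e i)).mono fun s hs =>
      hs.clm_apply (hasDerivAt_const s ξ)
    have ha2 := ((ContDiffAt.eventually_hasDerivAt_line hv2 (e i)).self_of_nhds.clm_apply
      (hasDerivAt_const (0 : ℝ) (e i))).clm_apply (hasDerivAt_const (0 : ℝ) ξ)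
    have hb1 := ContDiffAt.eventually_hasDerivAt_line hv4 (e i)
    have hb2 := (ContDiffAt.eventually_hasDerivAt_line hv3 (e i)).self_of_nhds.clm_apply
      (hasDerivAt_const (0 : ℝ) (e i))
    have hc1 : ∀ᶠ s : ℝ in 𝓝 0, HasDerivAt (fun s : ℝ => cutoff r (x + s • e i) t)
        (-(2 * inner ℝ x (e i) + 2 * s) / r ^ 2) s :=
      Eventually.of_forall fun s => hasDerivAt_cutoff_line r x (e i) t s (he1 i)
    have hc2 : HasDerivAt (fun s : ℝ => -(2 * inner ℝ x (e i) + 2 * s) / r ^ 2)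
        (-(2 / r ^ 2)) 0 := by
      have := ((((hasDerivAt_id (0 : ℝ)).const_mul 2).const_add
        (2 * inner ℝ x (e i))).fun_neg).div_const (r ^ 2)
      refine this.congr_deriv ?_
      ring
    simp only [map_zero, add_zero] at ha1 ha2 hb2
    have hlocal : IsLocalMax (fun s : ℝ => Real.log (fderiv ℝ v (x + s • e i) ξ) +
        Real.log (cutoff r (x + s • e i) t) - Real.log (2 * U - v (x + s • e i)) / 2) 0 := by
      have hpa : ∀ᶠ s : ℝ in 𝓝 0, 0 < fderiv ℝ v (x + s • e i) ξ := by
        refine ha1.self_of_nhds.continuousAt.eventually (lt_mem_nhds ?_)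
        simpa only [zero_smul, add_zero, hDξ] using hg
      filter_upwards [hpa, eventually_line (eventually_mem_paraboloid hp) (e i)] with s hs1 hs2
      rw [zero_smul, add_zero, hDξ]
      exact hgrad _ _ hs2 hs1
    have h := maximum_conditions_of_isLocalMax_log ha1 ha2
      (by simpa only [zero_smul, add_zero, hDξ] using hg) hb1 hb2
      (by simpa only [zero_smul, add_zero] using hN) hc1 hc2
      (by simpa only [zero_smul, add_zero] using hρ) hlocal
    simp only [zero_smul, add_zero, mul_zero, hDξ, hD2ξ, hD2, if_true, hDv] at h
    -- The second derivative of u_ξ along e_i becomes the ξ-derivative of u_{ii}, the form in which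
    -- it enters the differentiated equation.
    rw [fderiv_fderiv_fderiv_comm (hv4.of_le (by norm_cast))] at h
    exact h
  have htime : 0 ≤ fderiv ℝ (fun y => timeDeriv u y t) x ξ / g + 1 / r ^ 2 / cutoff r x t -
      -timeDeriv u x t / (2 * (2 * U - u x t)) := by
    have hg' : 0 < fderiv ℝ (fun y => u y t) x ξ := hg.trans_eq hDξ.symm
    have ha := hu.hasDerivWithinAt_fderiv hp ξ
    have hb := (hu.hasDerivWithinAt hp).mono (Iic_subset_Iic.2 hp.1)
    have hlocal : IsLocalMaxOn (fun s => Real.log (fderiv ℝ (fun y => u y s) x ξ) +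
        Real.log (cutoff r x s) - Real.log (2 * U - u x s) / 2) (Iic t) t := by
      have hpa : ∀ᶠ s in 𝓝[Iic t] t, 0 < fderiv ℝ (fun y => u y s) x ξ :=
        ha.continuousWithinAt.eventually (lt_mem_nhds hg')
      obtain ⟨δ, hδ, hbox⟩ := exists_box_subset_paraboloid hp
      have hnear : ∀ᶠ s in 𝓝[Iic t] t, t - δ < s :=
        nhdsWithin_le_nhds (lt_mem_nhds (by linarith))
      filter_upwards [hpa, hnear, self_mem_nhdsWithin] with s hs1 hs2 hs3
      have hs := hgrad x s (hbox x s (by simpa using hδ) hs2 hs3) hs1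
      rwa [← hDξ] at hs
    have h := time_condition_of_isLocalMaxOn_log ha hg' hb hN
      (hasDerivWithinAt_cutoff_time r x t (Iic t)) hρ hlocal
    rw [← hv, hDξ] at h
    rwa [neg_div, sub_neg_eq_add]
  have hσ : HasDerivAt (fun s : ℝ => sigma (k + 1) (eigenvalueVector (spaceHessian u (x + s • ξ) t)))
      (∑ i, esymmOn (Finset.univ.erase i) k lam *
        fderiv ℝ (fderiv ℝ (fderiv ℝ v)) x ξ (e i) (e i)) 0 := by
    exact hasDerivAt_sigma_spaceHessian hu hp hH ξ
  have hrhs : HasDerivAt (fun s : ℝ => ψ (x + s • ξ) t (u (x + s • ξ) t))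
      (-fderiv ℝ (fun y => timeDeriv u y t) x ξ * sigma (k + 1) lam + -timeDeriv u x t *
        ∑ i, esymmOn (Finset.univ.erase i) k lam *
          fderiv ℝ (fderiv ℝ (fderiv ℝ v)) x ξ (e i) (e i)) 0 := by
    have hw : DifferentiableAt ℝ (fun y => timeDeriv u y t) (x + (0 : ℝ) • ξ) := by
      rw [zero_smul, add_zero]
      exact (hu.space_contDiff 1 (by norm_num) (x, t) hp).differentiableAt (by norm_num)
    have h := (hasDerivAt_comp_line hw).fun_neg.fun_mul hσ
    simp only [zero_smul, add_zero, eigenvalueVector_eq hH] at h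
    refine h.congr_of_eventuallyEq ?_
    filter_upwards [eventually_line (eventually_mem_paraboloid hp) ξ] with s hs
    exact (hsol _ hs).symm
  have hdL := norm_deriv_rhs_le hψL hL hg hξ hp (by
    have := (ContDiffAt.eventually_hasDerivAt_line hv4 ξ).self_of_nhds
    simpa only [zero_smul, add_zero, hDξ] using this) hrhs
  have hlamΓ := hconv _ hp
  have hΨ := hsol _ hp
  have huxt := abs_le.1 (huU _ hp)
  simp only [eigenvalueVector_eq hH] at hlamΓ hΨ
  refine gradient_bound_of_maximum_conditions (ρ := cutoff r x t) (N := 2 * U - u x t)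
    (v := -timeDeriv u x t) (τ := fderiv ℝ (fun y => timeDeriv u y t) x ξ) hlamΓ
    (ξ := fun i => inner ℝ (e i) ξ) (η := fun i => -(2 * inner ℝ x (e i)) / r ^ 2)
    (T := fun i => fderiv ℝ (fderiv ℝ (fderiv ℝ v)) x ξ (e i) (e i))
    ?_ ?_ hr hm hU hg hρ (cutoff_le_one r x hp.1) (by linarith [huxt.2]) (by linarith [huxt.1])
    (hut _ hp) hUr (fun i => (hspace i).1) (fun i => (hspace i).2) htime rfl hdL
    (hΨ.trans_le (hψΨ _ hp _)) hK hK0 hK1 hK2 hK3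
  · rw [OrthonormalBasis.sum_sq_inner, hξ, one_pow]
  · have h1 : ∀ i, (-(2 * inner ℝ x (e i)) / r ^ 2) ^ 2 = 4 / r ^ 4 * inner ℝ (e i) x ^ 2 := by
      intro i
      rw [real_inner_comm]
      ring
    simp only [h1]
    rw [← Finset.mul_sum, OrthonormalBasis.sum_sq_inner]
    have h2 : ‖x‖ ^ 2 ≤ r ^ 2 := by
      have := hp.1
      have := hp.2
      simp only at *
      linarith
    calc 4 / r ^ 4 * ‖x‖ ^ 2 ≤ 4 / r ^ 4 * r ^ 2 := by gcongr
      _ = 4 / r ^ 2 := by field_simp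

end

/-! ### Existence of the maximum and the final estimate -/

section

open Filter Topology

variable {n : ℕ} {u : EuclideanSpace ℝ (Fin n) → ℝ → ℝ}

theorem paraboloid_subset_box (n : ℕ) (r : ℝ) :
    paraboloid n r ⊆ Metric.closedBall 0 |r| ×ˢ Icc (-r ^ 2) 0 := by
  rintro ⟨x, t⟩ ⟨h1, h2⟩
  simp only at h1 h2
  have hx : ‖x‖ ^ 2 ≤ |r| ^ 2 := by rw [sq_abs]; linarith
  exact ⟨by simpa using (sq_le_sq₀ (norm_nonneg x) (abs_nonneg r)).1 hx, by nlinarith [sq_nonneg ‖x‖], h1⟩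

theorem exists_norm_spaceGradient_le {r : ℝ} (hu : ParabolicCClosure 1 (paraboloid n r) u) :
    ∃ B > 0, ∀ p ∈ paraboloid n r, ‖spaceGradient u p.1 p.2‖ ≤ B := by
  obtain ⟨g, hg, hgu⟩ := hu.extends_closure 1 0 (by norm_num)
  have hc : IsCompact (closure (paraboloid n r)) :=
    ((isCompact_closedBall 0 |r|).prod isCompact_Icc).closure_of_subset (paraboloid_subset_box n r)
  obtain ⟨B, hB⟩ := hc.exists_bound_of_continuousOn hg
  refine ⟨max B 1, by positivity, fun p hp => ?_⟩
  rw [norm_spaceGradient, ← hgu hp]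
  exact (hB p (subset_closure hp)).trans (le_max_left _ _)

theorem zero_mem_paraboloid (n : ℕ) {r : ℝ} (hr : 0 < r) :
    ((0 : EuclideanSpace ℝ (Fin n)), (0 : ℝ)) ∈ paraboloid n r :=
  ⟨le_rfl, by simpa using pow_pos hr 2⟩

/-- The gradient is bounded because u is C^{2,1} up to the closure, so G is small where ρ is small,
and {G ≥ G(0,0)} lies in a compact set {ρ ≥ δ, t ≤ 0} inside D. -/
theorem exists_maximum {r U : ℝ} (hr : 0 < r) (hU : 0 < U)
    (hu : ParabolicCClosure 1 (paraboloid n r) u)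
    (huU : ∀ p ∈ paraboloid n r, |u p.1 p.2| ≤ U) (h0 : 0 < ‖spaceGradient u 0 0‖) :
    ∃ p ∈ paraboloid n r, 0 < ‖spaceGradient u p.1 p.2‖ ∧ ∀ q ∈ paraboloid n r,
      ‖spaceGradient u q.1 q.2‖ * cutoff r q.1 q.2 / √(2 * U - u q.1 q.2) ≤
        ‖spaceGradient u p.1 p.2‖ * cutoff r p.1 p.2 / √(2 * U - u p.1 p.2) := by
  set G : EuclideanSpace ℝ (Fin n) × ℝ → ℝ := fun q =>
    ‖spaceGradient u q.1 q.2‖ * cutoff r q.1 q.2 / √(2 * U - u q.1 q.2) with hG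
  obtain ⟨B, hB0, hB⟩ := exists_norm_spaceGradient_le hu
  have hN : ∀ q ∈ paraboloid n r, U ≤ 2 * U - u q.1 q.2 := fun q hq => by
    linarith [(abs_le.1 (huU q hq)).2]
  have hsqrt : ∀ q ∈ paraboloid n r, 0 < √(2 * U - u q.1 q.2) := fun q hq =>
    Real.sqrt_pos.2 (hU.trans_le (hN q hq))
  have hρ : ∀ q ∈ paraboloid n r, 0 < cutoff r q.1 q.2 := fun q hq =>
    ((mem_paraboloid_iff hr).1 hq).2
  have hz := zero_mem_paraboloid n hr
  set m := G (0, 0) with hm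
  have hm0 : 0 < m := div_pos (mul_pos h0 (hρ _ hz)) (hsqrt _ hz)
  -- From m ≤ G ≤ Bρ/√U one gets ρ ≥ m√U/B.
  set δ := m * √U / B with hδ
  have hδ0 : 0 < δ := by have := Real.sqrt_pos.2 hU; positivity
  have hcut : Continuous fun p : EuclideanSpace ℝ (Fin n) × ℝ => cutoff r p.1 p.2 := by
    unfold cutoff
    fun_prop
  set K := {p : EuclideanSpace ℝ (Fin n) × ℝ | p.2 ≤ 0 ∧ δ ≤ cutoff r p.1 p.2} with hK
  have hKD : K ⊆ paraboloid n r := fun p hp =>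
    (mem_paraboloid_iff hr).2 ⟨hp.1, hδ0.trans_le hp.2⟩
  have hKc : IsCompact K :=
    ((isCompact_closedBall 0 |r|).prod isCompact_Icc).of_isClosed_subset
      ((isClosed_le continuous_snd continuous_const).inter (isClosed_le continuous_const hcut))
      (hKD.trans (paraboloid_subset_box n r))
  have hmK : ∀ q ∈ paraboloid n r, m ≤ G q → q ∈ K := by
    intro q hq hmq
    refine ⟨hq.1, ?_⟩
    rw [hδ, div_le_iff₀ hB0]
    have h1 : m * √U ≤ m * √(2 * U - u q.1 q.2) :=
      mul_le_mul_of_nonneg_left (Real.sqrt_le_sqrt (hN q hq)) hm0.le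
    have h2 := (le_div_iff₀ (hsqrt q hq)).1 hmq
    have h3 := mul_le_mul_of_nonneg_right (hB q hq) (hρ q hq).le
    linarith
  have hGc : ContinuousOn G K := by
    refine ContinuousOn.mono ?_ hKD
    have hu1 : ParabolicC (0 + 1) (paraboloid n r) u := hu.toParabolicC
    exact (hu1.continuousOn_norm_spaceGradient.mul hcut.continuousOn).div
      (continuousOn_const.sub hu1.continuousOn_self).sqrt fun q hq => (hsqrt q hq).ne'
  have hzK := hmK _ hz le_rfl
  obtain ⟨p, hpK, hpmax⟩ := hKc.exists_isMaxOn ⟨_, hzK⟩ hGc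
  refine ⟨p, hKD hpK, ?_, fun q hq => ?_⟩
  · have h1 : 0 < G p := hm0.trans_le (hpmax hzK)
    refine (norm_nonneg _).lt_of_ne fun h => ?_
    simp [hG, ← h] at h1
  · rcases le_total m (G q) with h | h
    · exact hpmax (hmK q hq h)
    · exact h.trans (hpmax hzK)

/-- On the axis x = 0 the function drops by at least m₁r²/2 over [-r²/2, 0], while its oscillation
is at most 2U. In particular U > 0. -/
theorem mul_sq_le_of_le_neg_timeDeriv {r m₁ U : ℝ} (hr : 0 < r)
    (hu : ParabolicC 2 (paraboloid n r) u)
    (hut : ∀ p ∈ paraboloid n r, m₁ ≤ -timeDeriv u p.1 p.2)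
    (huU : ∀ p ∈ paraboloid n r, |u p.1 p.2| ≤ U) : m₁ * r ^ 2 ≤ 4 * U := by
  have hD : ∀ t ∈ Icc (-(r ^ 2 / 2)) 0, ((0 : EuclideanSpace ℝ (Fin n)), t) ∈ paraboloid n r := by
    intro t ht
    refine ⟨ht.2, ?_⟩
    simp only [norm_zero]
    nlinarith [ht.1, pow_pos hr 2]
  have hder : ∀ t ∈ Icc (-(r ^ 2 / 2)) 0, HasDerivWithinAt (fun s => u 0 s) (timeDeriv u 0 t)
      (Iic 0) t := fun t ht => ParabolicC.hasDerivWithinAt (m := 1) hu (hD t ht)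
  have hr2 : -(r ^ 2 / 2) ≤ 0 := by nlinarith [pow_pos hr 2]
  have hda : ∀ t ∈ interior (Icc (-(r ^ 2 / 2)) 0), HasDerivAt (fun s => u 0 s)
      (timeDeriv u 0 t) t := by
    intro t ht
    rw [interior_Icc] at ht
    exact (hder t (Ioo_subset_Icc_self ht)).hasDerivAt (Iic_mem_nhds ht.2)
  have h := (convex_Icc (-(r ^ 2 / 2)) 0).image_sub_le_mul_sub_of_deriv_le (f := fun s => u 0 s)
    (C := -m₁) (fun t ht => (hder t ht).continuousWithinAt.mono Icc_subset_Iic_self)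
    (fun t ht => (hda t ht).differentiableAt.differentiableWithinAt)
    (fun t ht => by
      rw [(hda t ht).deriv]
      linarith [hut _ (hD t (interior_subset ht))])
    _ (left_mem_Icc.2 hr2) _ (right_mem_Icc.2 hr2) hr2
  have h1 := (abs_le.1 (huU _ (hD _ (left_mem_Icc.2 hr2)))).2
  have h2 := (abs_le.1 (huU _ (hD _ (right_mem_Icc.2 hr2)))).1
  simp only at h h1 h2
  linarith

/-- The interior gradient estimate, given a bound `B` for the gradient at maximum points of the
auxiliary function. -/
theorem norm_spaceGradient_zero_le {k : ℕ} {r m₁ U L Ψ K B : ℝ}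
    {ψ : EuclideanSpace ℝ (Fin n) → ℝ → ℝ → ℝ}
    (hr : 0 < r) (hm : 0 < m₁) (hL : 0 ≤ L)
    (hψΨ : ∀ p ∈ paraboloid n r, ∀ z, ψ p.1 p.2 z ≤ Ψ)
    (hψL : LipschitzInXZ L (paraboloid n r) ψ) (hu : ParabolicC 2 (paraboloid n r) u)
    (hu' : ParabolicCClosure 1 (paraboloid n r) u)
    (hconv : KConvexMonotone (k + 1) (paraboloid n r) u)
    (hsol : IsSolution (k + 1) (paraboloid n r) ψ u)
    (hut : ∀ p ∈ paraboloid n r, m₁ ≤ -timeDeriv u p.1 p.2)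
    (huU : ∀ p ∈ paraboloid n r, |u p.1 p.2| ≤ U)
    (hK0 : 24 ≤ K) (hK1 : 2592 * n ≤ K ^ 2) (hK2 : 48 * n ≤ K ^ 2 * m₁)
    (hK3 : 288 * Ψ ≤ K ^ 2 * m₁ ^ 2) (hB0 : 0 ≤ B)
    (hB : ∀ g > 0, m₁ * g ^ 2 / (288 * U ^ 2) ≤ L * (1 / g + 2) → g ≤ B) :
    ‖spaceGradient u 0 0‖ ≤ 2 * (B + K * (U / r)) := by
  have hUr := mul_sq_le_of_le_neg_timeDeriv hr hu hut huU
  have hU : 0 < U := by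
    have : 0 < m₁ * r ^ 2 := by positivity
    linarith
  rcases (norm_nonneg (spaceGradient u 0 0)).eq_or_lt with h0 | h0
  · rw [← h0]
    positivity
  obtain ⟨⟨x, t⟩, hp, hg, hmax⟩ := exists_maximum hr hU hu' huU h0
  simp only at hg hmax
  have hρ := (mem_paraboloid_iff hr).1 hp
  have hz := zero_mem_paraboloid n hr
  have hbound : ‖spaceGradient u x t‖ * cutoff r x t ≤ B + K * (U / r) := by
    have hpos : 0 ≤ K * (U / r) := by positivity
    rcases le_total (K * U / r) (‖spaceGradient u x t‖ * cutoff r x t) with h | h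
    · have h1 := hB _ hg (gradient_bound_at_maximum hr hm hU hL hUr hψΨ hψL hu hconv.k_convex hsol
        hut huU hp hmax hg h hK0 hK1 hK2 hK3)
      have h2 := mul_le_of_le_one_right hg.le (cutoff_le_one r x hp.1)
      linarith
    · rw [← mul_div_assoc]
      linarith
  have hcmp := hmax _ hz
  have hcut0 : cutoff r (0 : EuclideanSpace ℝ (Fin n)) 0 = 1 := by simp [cutoff]
  have hN0 := abs_le.1 (huU _ hz)
  have hNp := abs_le.1 (huU _ hp)
  simp only [hcut0, mul_one] at hcmp hN0 hNp
  have hs0 : 0 < √(2 * U - u 0 0) := Real.sqrt_pos.2 (by linarith)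
  have hsp : 0 < √(2 * U - u x t) := Real.sqrt_pos.2 (by linarith)
  -- Both radicands lie in [U, 3U], and √3 ≤ 2.
  have hs : √(2 * U - u 0 0) ≤ 2 * √(2 * U - u x t) := by
    refine Real.sqrt_le_iff.2 ⟨by positivity, ?_⟩
    rw [mul_pow, Real.sq_sqrt (by linarith)]
    linarith
  rw [div_le_div_iff₀ hs0 hsp] at hcmp
  have hP : 0 ≤ ‖spaceGradient u x t‖ * cutoff r x t := mul_nonneg hg.le hρ.2.le
  have h1 : ‖spaceGradient u 0 0‖ * √(2 * U - u x t) ≤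
      2 * (‖spaceGradient u x t‖ * cutoff r x t) * √(2 * U - u x t) := by
    calc _ ≤ _ := hcmp
      _ ≤ ‖spaceGradient u x t‖ * cutoff r x t * (2 * √(2 * U - u x t)) := by gcongr
      _ = _ := by ring
  have h2 := le_of_mul_le_mul_right h1 hsp
  linarith

theorem le_of_mul_sq_div_le {m₁ U L g : ℝ} (hm : 0 < m₁) (hU : 0 < U) (hL : 0 ≤ L) (hg : 0 < g)
    (h : m₁ * g ^ 2 / (288 * U ^ 2) ≤ L * (1 / g + 2)) : g ≤ 1 + 864 * U ^ 2 * L / m₁ := by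
  have hpos : 0 ≤ 864 * U ^ 2 * L / m₁ := by positivity
  rcases le_total g 1 with h1 | h1
  · linarith
  · have h2 : 1 / g ≤ 1 := (div_le_one hg).2 h1
    have h3 : m₁ * g ^ 2 / (288 * U ^ 2) ≤ L * 3 := h.trans (by gcongr; linarith)
    rw [div_le_iff₀ (by positivity)] at h3
    have h4 : g ≤ 864 * U ^ 2 * L / m₁ := by
      rw [le_div_iff₀ hm]
      have := mul_le_mul_of_nonneg_left (le_self_pow₀ h1 two_ne_zero) hm.le
      linarith
    linarith

/-- The constant in the interior gradient estimate. -/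
def gradientConstant (n : ℕ) (m₁ Ψ : ℝ) : ℝ :=
  24 + 2592 * n + 48 * n / |m₁| + 288 * |Ψ| / m₁ ^ 2

theorem gradientConstant_ge (n : ℕ) (m₁ Ψ : ℝ) : 24 ≤ gradientConstant n m₁ Ψ := by
  have h1 : 0 ≤ 2592 * (n : ℝ) + 48 * n / |m₁| + 288 * |Ψ| / m₁ ^ 2 := by positivity
  unfold gradientConstant
  linarith

theorem gradientConstant_spec (n : ℕ) {m₁ : ℝ} (Ψ : ℝ) (hm : 0 < m₁) :
    2592 * n ≤ gradientConstant n m₁ Ψ ^ 2 ∧ 48 * n ≤ gradientConstant n m₁ Ψ ^ 2 * m₁ ∧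
      288 * Ψ ≤ gradientConstant n m₁ Ψ ^ 2 * m₁ ^ 2 := by
  have h24 := gradientConstant_ge n m₁ Ψ
  -- As K ≥ 1, K ≤ K², so each condition on K² follows from one summand of K.
  have hsq : gradientConstant n m₁ Ψ ≤ gradientConstant n m₁ Ψ ^ 2 :=
    le_self_pow₀ (by linarith) (by norm_num)
  have h1 : 0 ≤ 48 * (n : ℝ) / |m₁| := by positivity
  have h2 : 0 ≤ 288 * |Ψ| / m₁ ^ 2 := by positivity
  have h3 : 0 ≤ 2592 * (n : ℝ) := by positivity
  have hdef : gradientConstant n m₁ Ψ =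
    24 + 2592 * n + 48 * n / |m₁| + 288 * |Ψ| / m₁ ^ 2 := rfl
  refine ⟨by linarith, ?_, ?_⟩
  · rw [← div_le_iff₀ hm]
    rw [abs_of_pos hm] at *
    linarith
  · rw [← div_le_iff₀ (by positivity)]
    have : 288 * Ψ / m₁ ^ 2 ≤ 288 * |Ψ| / m₁ ^ 2 := by gcongr; exact le_abs_self Ψ
    linarith

end

end ParabolicHessian

end

theorem theorem1p1 :
    ∃ (C₁ : (n k : ℕ) → (r m₁ U L : ℝ) → ℝ) (C₂ : (n k : ℕ) → (m₁ Ψ : ℝ) → ℝ),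
      (∀ n k r m₁ U L, 0 < C₁ n k r m₁ U L) ∧
      (∀ n k m₁ Ψ, 0 < C₂ n k m₁ Ψ) ∧
      ∀ (n k : ℕ) (r m₁ U L Ψ : ℝ)
        (ψ : EuclideanSpace ℝ (Fin n) → ℝ → ℝ → ℝ)
        (u : EuclideanSpace ℝ (Fin n) → ℝ → ℝ),
        1 ≤ k → k ≤ n → 0 < r → 0 < m₁ →
        (∀ p ∈ ParabolicHessian.paraboloid n r, ∀ z, 0 ≤ ψ p.1 p.2 z) →
        (∀ p ∈ ParabolicHessian.paraboloid n r, ∀ z, ψ p.1 p.2 z ≤ Ψ) →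
        ParabolicHessian.LipschitzInXZ L (ParabolicHessian.paraboloid n r) ψ →
        ParabolicHessian.ParabolicC 2 (ParabolicHessian.paraboloid n r) u →
        ParabolicHessian.ParabolicCClosure 1 (ParabolicHessian.paraboloid n r) u →
        ParabolicHessian.KConvexMonotone k (ParabolicHessian.paraboloid n r) u →
        ParabolicHessian.IsSolution k (ParabolicHessian.paraboloid n r) ψ u →
        (∀ p ∈ ParabolicHessian.paraboloid n r,
          m₁ ≤ -ParabolicHessian.timeDeriv u p.1 p.2) →
        (∀ p ∈ ParabolicHessian.paraboloid n r, |u p.1 p.2| ≤ U) →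
        ‖ParabolicHessian.spaceGradient u 0 0‖ ≤ C₁ n k r m₁ U L + C₂ n k m₁ Ψ * (U / r) ∧
        ((∃ c : ℝ, ∀ p ∈ ParabolicHessian.paraboloid n r, ∀ z, ψ p.1 p.2 z = c) →
          ‖ParabolicHessian.spaceGradient u 0 0‖ ≤ C₂ n k m₁ Ψ * (U / r)) := by
  -- The absolute values keep the constants positive for all arguments, including inadmissible ones.
  refine ⟨fun n k r m₁ U L => 2 * (1 + 864 * U ^ 2 * |L| / |m₁|),
    fun n k m₁ Ψ => 2 * ParabolicHessian.gradientConstant n m₁ Ψ, fun n k r m₁ U L => by positivity,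
    fun n k m₁ Ψ => by linarith [ParabolicHessian.gradientConstant_ge n m₁ Ψ], ?_⟩
  intro n k r m₁ U L Ψ ψ u hk _ hr hm _ hψΨ hψL hu hu' hconv hsol hut huU
  obtain ⟨k, rfl⟩ := Nat.exists_eq_add_of_le' hk
  obtain ⟨hK1, hK2, hK3⟩ := ParabolicHessian.gradientConstant_spec n Ψ hm
  have hK0 := ParabolicHessian.gradientConstant_ge n m₁ Ψ
  have hU : 0 < U := by
    have h1 := ParabolicHessian.mul_sq_le_of_le_neg_timeDeriv hr hu hut huU
    have h2 : 0 < m₁ * r ^ 2 := by positivity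
    linarith
  have hψL' : ParabolicHessian.LipschitzInXZ |L| (ParabolicHessian.paraboloid n r) ψ :=
    fun x y t z w hx hy => (hψL x y t z w hx hy).trans
      (mul_le_mul_of_nonneg_right (le_abs_self L) (le_max_of_le_left (norm_nonneg _)))
  constructor
  · refine (ParabolicHessian.norm_spaceGradient_zero_le hr hm (abs_nonneg L) hψΨ hψL' hu hu' hconv
      hsol hut huU hK0 hK1 hK2 hK3 (B := 1 + 864 * U ^ 2 * |L| / |m₁|) (by positivity)
      fun g hg h => ?_).trans_eq (by ring)
    rw [abs_of_pos hm]
    exact ParabolicHessian.le_of_mul_sq_div_le hm hU (abs_nonneg L) hg h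
  -- Constant ψ allows L = 0. The inequality at a maximum with large gradient then fails for every g
  -- > 0, so B = 0 is admissible.
  · rintro ⟨c, hc⟩
    have hψ0 : ParabolicHessian.LipschitzInXZ 0 (ParabolicHessian.paraboloid n r) ψ := by
      intro x y t z w hx hy
      rw [hc (x, t) hx, hc (y, t) hy]
      simp
    refine (ParabolicHessian.norm_spaceGradient_zero_le hr hm le_rfl hψΨ hψ0 hu hu' hconv
      hsol hut huU hK0 hK1 hK2 hK3 (B := 0) le_rfl fun g hg h => ?_).trans_eq (by ring)
    have h1 : 0 < m₁ * g ^ 2 / (288 * U ^ 2) := by positivity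
    rw [zero_mul] at h
    linarith
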